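/- Let $n\ge 1$ be an integer, and let $x_1,\dots,x_n,y,z$ be the coordinates of $\mathbb{C}^{n+2}$. For a polynomial $P$ let $V(P)$ denote its zero set. A polynomial automorphism of $\mathbb{C}^N$ is a polynomial map $\mathbb{C}^N\to\mathbb{C}^N$ that has a polynomial inverse. Two hypersurfaces $H_1,H_2\subset\mathbb{C}^N$ are called equivalent if $\Phi(H_1)=H_2$ for some polynomial automorphism $\Phi$ of $\mathbb{C}^N$. Two polynomials $P,Q\in\mathbb{C}[t_1,\dots,t_N]$ are called equivalent if $P\circ\Phi=Q$ for some polynomial automorphism $\Phi$ of $\mathbb{C}^N$, and stably equivalent if there is an integer $m\ge 0$ such that $P$ and $Q$ are equivalent when regarded as polynomials in $\mathbb{C}[t_1,\dots,t_{N+m}]$. Two algebraic sets in affine spaces are isomorphic if there are mutually inverse maps between them which are restrictions of polynomial maps. 1. Let $P_a=x_1^2\cdots x_n^2\,y+z^2+x_1\cdots x_n(z^2-a)$, and let $H_1=V(P_1-1)$ and $H_2=V(P_2-1)$, i.e. the hypersurfaces in $\mathbb{C}^{n+2}$ defined by $$x_1^2\cdots x_n^2\,y+z^2+x_1\cdots x_n(z^2-1)=1\quad\text{and}\quad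 x_1^2\cdots x_n^2\,y+z^2+x_1\cdots x_n(z^2-2)=1 .$$ Then $H_1$ and $H_2$ are not isomorphic as algebraic varieties (in particular, they are not equivalent hypersurfaces), but the cylinders $H_1\times\mathbb{C}$ and $H_2\times\mathbb{C}$ are equivalent hypersurfaces in $\mathbb{C}^{n+3}$; moreover, the polynomials $P_1-1$ and $P_2-1$ are stably equivalent. 2. For $k\ge 1$ let $Q_k=x_1^2\cdots x_n^2\,y+z^2+x_1\cdots x_n(z^2-1)^k\in\mathbb{C}[x_1,\dots,x_n,y,z]$. Then $Q_k$ and $Q_{k'}$ are stably equivalent polynomials for all $k,k'\ge 1$, whereas the hypersurfaces $V(Q_k)$ and $V(Q_{k'})$ in $\mathbb{C}^{n+2}$ are not equivalent whenever $k\ne k'$. However, the varieties $V(Q_k-c)$ and $V(Q_{k'}-c)$ are isomorphic for all $k,k'\ge 1$ and every $c\in\mathbb{C}$. -/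

import Mathlib

noncomputable section

namespace StableEquiv

open MvPolynomial

/-- Affine space `ℂ^N`. -/
abbrev AffSpace (N : ℕ) : Type := Fin N → ℂ

/-- The polynomial ring `ℂ^[N]` in `N` variables, i.e. the coordinate ring of `ℂ^N`. -/
abbrev PolyRing (N : ℕ) : Type := MvPolynomial (Fin N) ℂ

/-- The polynomial map `ℂ^N → ℂ^M` with components `F 0, …, F (M - 1)`. -/
def polyMap {N M : ℕ} (F : Fin M → PolyRing N) (p : AffSpace N) : AffSpace M :=
  fun j => eval p (F j)

/-- The zero set `V(P)` in `ℂ^N` of a polynomial `P`. -/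
def zeroSet {N : ℕ} (P : PolyRing N) : Set (AffSpace N) :=
  {p | eval p P = 0}

/-- Two closed algebraic subsets `V ⊆ ℂ^N`, `W ⊆ ℂ^M` are isomorphic (as affine algebraic
varieties) if there are mutually inverse regular maps between them; a regular map between
closed algebraic subsets of affine spaces is the restriction of a polynomial map. -/
def IsomorphicVarieties {N M : ℕ} (V : Set (AffSpace N)) (W : Set (AffSpace M)) : Prop :=
  ∃ (F : Fin M → PolyRing N) (G : Fin N → PolyRing M),
    Set.MapsTo (polyMap F) V W ∧ Set.MapsTo (polyMap G) W V ∧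
      Set.LeftInvOn (polyMap G) (polyMap F) V ∧ Set.RightInvOn (polyMap G) (polyMap F) W

/-- A polynomial automorphism of `ℂ^N`: a polynomial map with a polynomial inverse. -/
structure PolyAut (N : ℕ) where
  /-- the components of the automorphism -/
  comp : Fin N → PolyRing N
  /-- the components of the inverse automorphism -/
  invComp : Fin N → PolyRing N
  left_inv : Function.LeftInverse (polyMap invComp) (polyMap comp)
  right_inv : Function.RightInverse (polyMap invComp) (polyMap comp)

/-- The self-map of `ℂ^N` underlying a polynomial automorphism. -/
def PolyAut.toMap {N : ℕ} (Φ : PolyAut N) : AffSpace N → AffSpace N :=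
  polyMap Φ.comp

/-- The pull-back `Φ^*(P) = P ∘ Φ` of a polynomial: substitute the components of `Φ` for the
variables. -/
def PolyAut.pullback {N : ℕ} (Φ : PolyAut N) (P : PolyRing N) : PolyRing N :=
  aeval Φ.comp P

/-- Two subvarieties of `ℂ^N` are equivalent if a polynomial automorphism of `ℂ^N` maps the
first one onto the second one. -/
def EquivalentVarieties {N : ℕ} (H₁ H₂ : Set (AffSpace N)) : Prop :=
  ∃ Φ : PolyAut N, Φ.toMap '' H₁ = H₂

/-- Two polynomials are equivalent if a polynomial automorphism `Φ` satisfies `Φ^*(P) = Q`. -/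
def EquivalentPolynomials {N : ℕ} (P Q : PolyRing N) : Prop :=
  ∃ Φ : PolyAut N, Φ.pullback P = Q

/-- The cylinder `H × ℂ^m` in `ℂ^(N+m)`; the first `N` coordinates are those of `ℂ^N`. -/
def cylinder {N : ℕ} (H : Set (AffSpace N)) (m : ℕ) : Set (AffSpace (N + m)) :=
  {p | (fun i : Fin N => p (Fin.castAdd m i)) ∈ H}

/-- Two polynomials in `ℂ^[N]` are stably equivalent if, for some `m`, they are equivalent when
regarded as polynomials in `ℂ^[N+m]`. -/
def StablyEquivalentPolynomials {N : ℕ} (P Q : PolyRing N) : Prop :=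
  ∃ m : ℕ, EquivalentPolynomials
    (rename (Fin.castAdd m) P : PolyRing (N + m)) (rename (Fin.castAdd m) Q : PolyRing (N + m))

/-- The product `x₁ ⋯ xₙ` in `ℂ[x₁, …, xₙ, y, z]`; the coordinates of `ℂ^(n+2)` are ordered as
`x₁, …, xₙ, y, z`. -/
def xProd (n : ℕ) : PolyRing (n + 2) := ∏ i : Fin n, X (Fin.castAdd 2 i)

/-- The variable `y` of `ℂ[x₁, …, xₙ, y, z]`. -/
def yVar (n : ℕ) : PolyRing (n + 2) := X (Fin.natAdd n 0)

/-- The variable `z` of `ℂ[x₁, …, xₙ, y, z]`. -/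
def zVar (n : ℕ) : PolyRing (n + 2) := X (Fin.natAdd n 1)

/-- The polynomial `x₁² ⋯ xₙ² y + z² + x₁ ⋯ xₙ (z² - a)`. -/
def polyP (n : ℕ) (a : ℂ) : PolyRing (n + 2) :=
  xProd n ^ 2 * yVar n + zVar n ^ 2 + xProd n * (zVar n ^ 2 - C a)

/-- The polynomial `Q_k = x₁² ⋯ xₙ² y + z² + x₁ ⋯ xₙ (z² - 1)^k`. -/
def polyQ (n k : ℕ) : PolyRing (n + 2) :=
  xProd n ^ 2 * yVar n + zVar n ^ 2 + xProd n * (zVar n ^ 2 - 1) ^ k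

end StableEquiv

end

/-!
Write `u = x₁ ⋯ xₙ`. All polynomials in question have the form `u² y + z² + u q(z²) - c`, with
`q = X - a` or `q = (X - 1)^k` (`hyperPoly`).

*Isomorphisms.* On the hypersurface `z² ≡ c` modulo `u`, so `q(z²)` may be replaced by the constant
`q(c)` by a change of the coordinate `y` (`exists_normalization`). Rescaling one of the `xᵢ`
multiplies this constant by any nonzero number. Hence the hypersurfaces of `q` and `q'` over the
same `c` are isomorphic as soon as `q(c)` and `q'(c)` vanish simultaneously
(`isomorphic_of_eval_eq_zero_iff`).

*Stable equivalence.* In the variables `z, w`, the commutator of the shears `z ↦ z + u w` and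
`w ↦ w + f(z)` is an automorphism that modulo `u²` adds `u f(z)` to `z`. If `q(0) = q'(0)`, then
`2 z f(z) = q'(z²) - q(z²)` has a solution `f`, and this automorphism carries `z² + u q(z²)` to
`z² + u q'(z²)` modulo `u²`; the error is absorbed by `y`. If `q(0)` and `q'(0)` are merely
nonzero, one `xᵢ` is rescaled as well (`equivalent_rename_hyperPoly`).

*Non-isomorphism.* The coordinate ring `A` of `u² y + z² + α u = c` embeds into Laurent polynomials
in `z, x₁, …, xₙ` by solving the equation for `y`. Exponents are ordered lexicographically with `z`
first, and the leading exponents of elements of `A` form an explicit monoid. The leading part of a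
locally nilpotent derivation of `A` acts on monomials by a linear form, and local nilpotency makes
that form integral on the monoid; a parity argument then shows that it vanishes on every `xᵢ`
(`lead_of_locallyNilpotent`). So the kernel of every nonzero locally nilpotent derivation lies in
`ℂ[x₁, …, xₙ]`. Applied to the transport of `u² ∂/∂z` along an isomorphism `Ψ` of two such rings,
this yields that `Ψ` preserves `ℂ[x₁, …, xₙ]`, that `Ψ u = μ u` and `Ψ z = β z + γ(x)` with
constants `μ`, `β`, and comparison of the equations modulo `u²` relates the parameters:
`c = β² c'` and `α μ = β² α'` (`exists_scalars_of_coordRing_equiv`). In particular `α` and `α'`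
vanish simultaneously, which separates `V(P₁ - 1)` from `V(P₂ - 1)`.

*Inequivalence of the `V(Q_k)`.* An automorphism of `ℂ^(n+2)` that maps one onto the other
multiplies the equation by a constant `s`, so it maps fibres to fibres, and the previous relation
holds on all of them. The factor `μ` is a polynomial function of the fibre without zeros, hence
constant, and the relation `(s c - 1)^l μ = s (c - 1)^k` for all `c ≠ 0` forces `k = l`.
-/

namespace StableEquiv

/-! ### Leading exponents in group algebras of ordered groups -/

section Leading

variable {M : Type*} [LinearOrder M]

/-- Every exponent of `f` is at most `v`, and `c` is the coefficient of `f` at `v`. The value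
`c = 0` is allowed, and then all exponents of `f` are strictly smaller than `v`. -/
def HasLead (f : AddMonoidAlgebra ℂ M) (v : M) (c : ℂ) : Prop :=
  f.coeff v = c ∧ ∀ w, v < w → f.coeff w = 0

lemma hasLead_single (v : M) (c : ℂ) : HasLead (AddMonoidAlgebra.single v c) v c := by
  refine ⟨by simp, fun w hw => ?_⟩
  simp [hw.ne]

lemma exists_hasLead {f : AddMonoidAlgebra ℂ M} (hf : f ≠ 0) : ∃ v c, c ≠ 0 ∧ HasLead f v c := by
  have hs : f.coeff.support.Nonempty := by
    rw [Finsupp.support_nonempty_iff]; simpa using hf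
  refine ⟨f.coeff.support.max' hs, _, ?_, rfl, fun w hw => ?_⟩
  · exact Finsupp.mem_support_iff.mp (Finset.max'_mem _ hs)
  · by_contra h
    exact absurd (Finset.le_max' _ w (Finsupp.mem_support_iff.mpr h)) (not_le.mpr hw)

lemma HasLead.unique {f : AddMonoidAlgebra ℂ M} {v w : M} {c d : ℂ} (hv : HasLead f v c)
    (hw : HasLead f w d) (hc : c ≠ 0) (hd : d ≠ 0) : v = w := by
  rcases lt_trichotomy v w with h | h | h
  · exact absurd (hw.1.symm.trans (hv.2 w h)) hd
  · exact h
  · exact absurd (hv.1.symm.trans (hw.2 v h)) hc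

lemma HasLead.le {f : AddMonoidAlgebra ℂ M} {v w : M} {c : ℂ} (hv : HasLead f v c)
    (hw : f.coeff w ≠ 0) : w ≤ v := by
  by_contra h
  exact hw (hv.2 w (not_le.mp h))

/-- In a linear combination of elements with pairwise distinct leading exponents, the leading terms
do not cancel: the leading exponent of the combination is the largest leading exponent of the
elements that occur in it. -/
lemma exists_lead_of_mem_span {ι : Type*} {b : ι → AddMonoidAlgebra ℂ M} {e : ι → M}
    (he : Function.Injective e) {d : ι → ℂ} (hd : ∀ s, d s ≠ 0) (hb : ∀ s, HasLead (b s) (e s) (d s))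
    {f : AddMonoidAlgebra ℂ M} (hf : f ∈ Submodule.span ℂ (Set.range b)) (hf0 : f ≠ 0) :
    ∃ s c, c ≠ 0 ∧ HasLead f (e s) c ∧
      f ∈ Submodule.span ℂ (b '' {t | e t ≤ e s}) := by
  obtain ⟨l, rfl⟩ := (Finsupp.mem_span_range_iff_exists_finsupp).mp hf
  have hl : l.support.Nonempty := by
    rw [Finsupp.support_nonempty_iff]; rintro rfl; simp at hf0
  obtain ⟨s, hs, hmax⟩ := Finset.exists_max_image l.support e hl
  refine ⟨s, l s * d s, mul_ne_zero (Finsupp.mem_support_iff.mp hs) (hd s), ⟨?_, ?_⟩, ?_⟩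
  · rw [AddMonoidAlgebra.coeff_finsuppSum, Finsupp.sum, Finsupp.finsetSum_apply,
      Finset.sum_eq_single s]
    · simp [(hb s).1]
    · intro t ht hts
      have : e t < e s := lt_of_le_of_ne (hmax t ht) (fun h => hts (he h))
      simp [(hb t).2 _ this]
    · intro h; exact absurd hs h
  · intro w hw
    rw [AddMonoidAlgebra.coeff_finsuppSum, Finsupp.sum, Finsupp.finsetSum_apply]
    refine Finset.sum_eq_zero fun t ht => ?_
    simp [(hb t).2 _ ((hmax t ht).trans_lt hw)]
  · refine Submodule.sum_mem _ fun t ht => Submodule.smul_mem _ _ (Submodule.subset_span ?_)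
    exact ⟨t, hmax t ht, rfl⟩

variable [AddCommGroup M] [IsOrderedAddMonoid M]

lemma HasLead.mul {f g : AddMonoidAlgebra ℂ M} {v w : M} {c d : ℂ}
    (hf : HasLead f v c) (hg : HasLead g w d) : HasLead (f * g) (v + w) (c * d) := by
  constructor
  · rw [AddMonoidAlgebra.coeff_mul_apply_left, Finsupp.sum, Finset.sum_eq_single v]
    · simp [hf.1, hg.1]
    · intro x _ hxv
      rcases lt_or_gt_of_ne hxv with h | h
      · rw [hg.2 _ (by rw [← sub_pos] at h ⊢; convert h using 1; abel), mul_zero]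
      · rw [hf.2 _ h, zero_mul]
    · intro h
      rw [Finsupp.notMem_support_iff.mp h, zero_mul]
  · intro y hy
    rw [AddMonoidAlgebra.coeff_mul_apply_left, Finsupp.sum]
    refine Finset.sum_eq_zero fun x _ => ?_
    rcases lt_or_ge v x with h | h
    · rw [hf.2 _ h, zero_mul]
    · rw [hg.2 _ ?_, mul_zero]
      calc w < -v + y := by rw [← sub_pos] at hy ⊢; convert hy using 1; abel
        _ ≤ -x + y := by gcongr

lemma HasLead.pow {f : AddMonoidAlgebra ℂ M} {v : M} {c : ℂ} (hf : HasLead f v c) (k : ℕ) :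
    HasLead (f ^ k) (k • v) (c ^ k) := by
  induction k with
  | zero => simpa [AddMonoidAlgebra.one_def] using hasLead_single (0 : M) 1
  | succ k ih => simpa [pow_succ, succ_nsmul] using ih.mul hf

/-- The derivation of the group algebra with `χ^v ↦ T v * χ^v`, for an additive map `T`. Every
derivation of a group algebra has this form. -/
noncomputable def expDerivation (T : M →+ AddMonoidAlgebra ℂ M) :
    Derivation ℂ (AddMonoidAlgebra ℂ M) (AddMonoidAlgebra ℂ M) :=
  Derivation.mk'
    ((Finsupp.linearCombination ℂ fun v => T v * AddMonoidAlgebra.single v 1) ∘ₗ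
      (AddMonoidAlgebra.coeffLinearEquiv ℂ).toLinearMap) (by
    intro a b
    induction a using AddMonoidAlgebra.induction_linear with
    | zero => simp
    | add f g hf hg => simp only [add_mul, map_add, hf, hg, smul_eq_mul, mul_add]; ring
    | single v c =>
      induction b using AddMonoidAlgebra.induction_linear with
      | zero => simp
      | add f g hf hg => simp only [mul_add, map_add, hf, hg, smul_eq_mul, add_mul]; ring
      | single w d =>
        have h1 : ∀ (v : M) (c : ℂ), AddMonoidAlgebra.single v c =
          c • AddMonoidAlgebra.single v (1 : ℂ) := by intro v c; simp
        rw [AddMonoidAlgebra.single_mul_single]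
        simp only [LinearMap.comp_apply, LinearEquiv.coe_coe,
          AddMonoidAlgebra.coeffLinearEquiv_apply, AddMonoidAlgebra.coeff_single,
          Finsupp.linearCombination_single, map_add, smul_eq_mul]
        rw [h1 v c, h1 w d]
        have h2 : AddMonoidAlgebra.single (v + w) (1 : ℂ) =
          AddMonoidAlgebra.single v (1 : ℂ) * AddMonoidAlgebra.single w (1 : ℂ) := by
          simp [AddMonoidAlgebra.single_mul_single]
        rw [h2]
        simp only [Algebra.smul_def, map_mul]
        ring)

omit [LinearOrder M] [IsOrderedAddMonoid M] in
lemma expDerivation_single (T : M →+ AddMonoidAlgebra ℂ M) (v : M) (c : ℂ) :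
    expDerivation T (AddMonoidAlgebra.single v c) = T v * AddMonoidAlgebra.single v c := by
  have h : AddMonoidAlgebra.single v c = c • AddMonoidAlgebra.single v (1 : ℂ) := by simp
  rw [h, mul_smul_comm]
  simp [expDerivation]

lemma expDerivation_hasLead {T : M →+ AddMonoidAlgebra ℂ M} {e : M} {l : M → ℂ}
    (hT : ∀ v, HasLead (T v) e (l v)) {f : AddMonoidAlgebra ℂ M} {v : M} {c : ℂ}
    (hf : HasLead f v c) : HasLead (expDerivation T f) (v + e) (l v * c) := by
  have key : ∀ x, (expDerivation T f).coeff x =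
      f.coeff.sum fun w a => a * (T w).coeff (x - w) := by
    intro x
    conv_lhs => rw [← AddMonoidAlgebra.sum_coeff_single f]
    rw [Finsupp.sum, map_sum, AddMonoidAlgebra.coeff_sum, Finsupp.finsetSum_apply, Finsupp.sum]
    refine Finset.sum_congr rfl fun w _ => ?_
    rw [expDerivation_single, AddMonoidAlgebra.coeff_mul_single_apply, sub_eq_add_neg, mul_comm]
  constructor
  · rw [key, Finsupp.sum, Finset.sum_eq_single v]
    · rw [add_sub_cancel_left, (hT v).1, hf.1, mul_comm]
    · intro w _ hwv
      rcases lt_or_gt_of_ne hwv with h | h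
      · rw [(hT w).2 _ (by rw [← sub_pos] at h ⊢; convert h using 1; abel), mul_zero]
      · rw [hf.2 _ h, zero_mul]
    · intro h
      rw [Finsupp.notMem_support_iff.mp h, zero_mul]
  · intro x hx
    rw [key, Finsupp.sum]
    refine Finset.sum_eq_zero fun w _ => ?_
    rcases lt_or_ge v w with h | h
    · rw [hf.2 _ h, zero_mul]
    · rw [(hT w).2 _ ?_, mul_zero]
      calc e < x - v := by rw [← sub_pos] at hx ⊢; convert hx using 1; abel
        _ ≤ x - w := by gcongr

lemma expDerivation_iterate_hasLead {T : M →+ AddMonoidAlgebra ℂ M} {e : M} {l : M →+ ℂ}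
    (hT : ∀ v, HasLead (T v) e (l v)) {f : AddMonoidAlgebra ℂ M} {v : M} {c : ℂ}
    (hf : HasLead f v c) (k : ℕ) :
    HasLead ((expDerivation T)^[k] f) (v + k • e) ((∏ i ∈ Finset.range k, (l v + i * l e)) * c) := by
  induction k with
  | zero => simpa using hf
  | succ k ih =>
    rw [Function.iterate_succ_apply', succ_nsmul, ← add_assoc, Finset.prod_range_succ]
    convert expDerivation_hasLead hT ih using 1
    simp
    ring

/-- The value of `l` at the leading exponent of an element killed by a power of the derivation is
one of the first multiples of `-l e`. -/
lemma exists_nat_of_iterate_eq_zero {T : M →+ AddMonoidAlgebra ℂ M} {e : M} {l : M →+ ℂ}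
    (hT : ∀ v, HasLead (T v) e (l v)) {f : AddMonoidAlgebra ℂ M} {v : M} {c : ℂ}
    (hf : HasLead f v c) (hc : c ≠ 0) {k : ℕ} (hk : (expDerivation T)^[k] f = 0) :
    ∃ i : ℕ, l v + i * l e = 0 := by
  have h := (expDerivation_iterate_hasLead hT hf k).1
  rw [hk] at h
  have h' := (mul_eq_zero.mp h.symm).resolve_right hc
  obtain ⟨i, _, hi⟩ := Finset.prod_eq_zero_iff.mp h'
  exact ⟨i, hi⟩

end Leading

open MvPolynomial

/-! ### The coordinate ring of `u² y + z² + α u = c` inside a Laurent polynomial ring -/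

/-- Exponents of Laurent monomials in `z, x₁, …, xₙ`, ordered lexicographically. The coordinate
`0` is the exponent of `z`, which therefore dominates. -/
abbrev Expo (n : ℕ) : Type := Lex (Fin (n + 1) → ℤ)

/-- Laurent polynomials in `z, x₁, …, xₙ`. -/
abbrev Laurent (n : ℕ) : Type := AddMonoidAlgebra ℂ (Expo n)

variable {n : ℕ}

lemma expo_lt_of_zero_lt {v w : Expo n} (h : v 0 < w 0) : v < w :=
  ⟨0, fun j hj => absurd hj (Fin.not_lt_zero j), h⟩

lemma expo_zero_le_of_le {v w : Expo n} (h : v ≤ w) : v 0 ≤ w 0 := by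
  by_contra h'
  exact absurd (expo_lt_of_zero_lt (not_le.mp h')) (not_lt.mpr h)

@[simp] lemma expo_add_apply (v w : Expo n) (i : Fin (n + 1)) : (v + w) i = v i + w i := rfl

@[simp] lemma expo_sub_apply (v w : Expo n) (i : Fin (n + 1)) : (v - w) i = v i - w i := rfl

@[simp] lemma expo_neg_apply (v : Expo n) (i : Fin (n + 1)) : (-v) i = -v i := rfl

@[simp] lemma expo_zero_apply (i : Fin (n + 1)) : (0 : Expo n) i = 0 := rfl

@[simp] lemma expo_nsmul_apply (k : ℕ) (v : Expo n) (i : Fin (n + 1)) : (k • v) i = k * v i := by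
  change k • (v i) = _
  simp

@[simp] lemma expo_mul_apply (v w : Expo n) (i : Fin (n + 1)) : (v * w) i = v i * w i := rfl

@[simp] lemma expo_natCast_apply (k : ℕ) (i : Fin (n + 1)) : (k : Expo n) i = k := rfl

@[simp] lemma expo_ofNat_apply (k : ℕ) [k.AtLeastTwo] (i : Fin (n + 1)) :
    (ofNat(k) : Expo n) i = k := rfl

@[simp] lemma expo_intCast_apply (k : ℤ) (i : Fin (n + 1)) : (k : Expo n) i = k := rfl

/-- The exponent of `xᵢ`. -/
def expX (i : Fin n) : Expo n := toLex (Pi.single i.succ 1)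

/-- The exponent of `z`. -/
def expZ : Expo n := toLex (Pi.single 0 1)

/-- The exponent of `u = x₁ ⋯ xₙ`. -/
def expU : Expo n := toLex (Fin.cons 0 fun _ => 1)

@[simp] lemma expX_zero (i : Fin n) : expX i 0 = 0 := by simp [expX]
@[simp] lemma expX_succ (i j : Fin n) : expX i j.succ = if j = i then 1 else 0 := by
  simp [expX, Pi.single_apply]
@[simp] lemma expZ_zero : (expZ : Expo n) 0 = 1 := by simp [expZ]
@[simp] lemma expZ_succ (j : Fin n) : (expZ : Expo n) j.succ = 0 := by simp [expZ]
@[simp] lemma expU_zero : (expU : Expo n) 0 = 0 := rfl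
@[simp] lemma expU_succ (j : Fin n) : (expU : Expo n) j.succ = 1 := rfl

lemma expo_ext {v w : Expo n} (h0 : v 0 = w 0) (h : ∀ i : Fin n, v i.succ = w i.succ) : v = w := by
  funext i
  exact Fin.cases h0 h i

/-- The Laurent monomial with exponent `v`. -/
noncomputable def mono (v : Expo n) : Laurent n := AddMonoidAlgebra.single v 1

lemma mono_zero : mono (0 : Expo n) = 1 := rfl

lemma mono_add (v w : Expo n) : mono (v + w) = mono v * mono w := by
  simp [mono, AddMonoidAlgebra.single_mul_single]

lemma mono_nsmul (k : ℕ) (v : Expo n) : mono (k • v) = mono v ^ k := by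
  simp [mono, AddMonoidAlgebra.single_pow]

lemma mono_mul_neg (v : Expo n) : mono v * mono (-v) = 1 := by
  rw [← mono_add, add_neg_cancel, mono_zero]

lemma hasLead_mono (v : Expo n) : HasLead (mono v) v 1 := hasLead_single v 1

lemma coeff_mono_mul (v w : Expo n) (f : Laurent n) :
    (mono v * f).coeff w = f.coeff (w - v) := by
  rw [mono, AddMonoidAlgebra.coeff_single_mul_apply, one_mul, neg_add_eq_sub]

lemma laurent_ext {f g : Laurent n} (h : ∀ v, f.coeff v = g.coeff v) : f = g :=
  AddMonoidAlgebra.coeff_injective (Finsupp.ext h)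

/-- The function `y = (c - z² - α u) / u²` on the hypersurface `u² y + z² + α u = c`. -/
noncomputable def laurentY (α c : ℂ) : Laurent n :=
  mono (-(2 • expU)) * (algebraMap ℂ _ c - mono expZ ^ 2 - algebraMap ℂ _ α * mono expU)

lemma laurentY_spec (α c : ℂ) : mono expU ^ 2 * laurentY α c =
    algebraMap ℂ (Laurent n) c - mono expZ ^ 2 - algebraMap ℂ _ α * mono expU := by
  rw [laurentY, ← mul_assoc, ← mono_nsmul, mono_mul_neg, one_mul]

lemma hasLead_laurentY (α c : ℂ) :
    HasLead (laurentY α c : Laurent n) (2 • expZ - 2 • expU) (-1) := by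
  have hA : ∀ (v : Expo n) (a : ℂ) (w : Expo n), w ≠ v →
      (AddMonoidAlgebra.single v a).coeff w = 0 := by
    intro v a w h
    rw [AddMonoidAlgebra.coeff_single, Finsupp.single_eq_of_ne h]
  have h1 : (laurentY α c : Laurent n) = AddMonoidAlgebra.single (2 • expZ - 2 • expU) (-1) +
      AddMonoidAlgebra.single (-(2 • expU)) c + AddMonoidAlgebra.single (-expU) (-α) := by
    have h2 : (-expU : Expo n) = -(2 • expU) + expU := by abel
    have h3 : (2 • expZ - 2 • expU : Expo n) = -(2 • expU) + 2 • expZ := by abel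
    rw [laurentY, ← mono_nsmul, h3, h2]
    simp only [mono, AddMonoidAlgebra.coe_algebraMap, Function.comp, mul_sub,
      AddMonoidAlgebra.single_mul_single, Algebra.algebraMap_self, RingHom.id_apply, zero_add,
      add_zero, one_mul, mul_one, AddMonoidAlgebra.single_neg]
    abel
  have hlt : ∀ v w : Expo n, 2 • expZ - 2 • expU ≤ v → w 0 = 0 → v ≠ w := by
    rintro v w hv hw rfl
    have := expo_zero_le_of_le hv
    simp [hw] at this
  rw [h1]
  constructor
  · rw [AddMonoidAlgebra.coeff_add, AddMonoidAlgebra.coeff_add, Finsupp.add_apply,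
      Finsupp.add_apply, hA (-(2 • expU)) _ _ (hlt _ _ le_rfl (by simp)),
      hA (-expU) _ _ (hlt _ _ le_rfl (by simp)), AddMonoidAlgebra.coeff_single,
      Finsupp.single_eq_same, add_zero, add_zero]
  · intro w hw
    rw [AddMonoidAlgebra.coeff_add, AddMonoidAlgebra.coeff_add, Finsupp.add_apply,
      Finsupp.add_apply, hA (-(2 • expU)) _ _ (hlt _ _ hw.le (by simp)),
      hA (-expU) _ _ (hlt _ _ hw.le (by simp)), hA _ _ _ hw.ne', add_zero, add_zero]

/-- The point with coordinates `x₁, …, xₙ, y, z`. -/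
def coords {R : Type*} (x : Fin n → R) (y z : R) : Fin (n + 2) → R := Fin.append x ![y, z]

@[simp] lemma coords_x {R : Type*} (x : Fin n → R) (y z : R) (i : Fin n) :
    coords x y z (Fin.castAdd 2 i) = x i := by simp [coords]

@[simp] lemma coords_y {R : Type*} (x : Fin n → R) (y z : R) :
    coords x y z (Fin.natAdd n 0) = y := by simp [coords]

@[simp] lemma coords_z {R : Type*} (x : Fin n → R) (y z : R) :
    coords x y z (Fin.natAdd n 1) = z := by simp [coords]

lemma forall_coords {P : Fin (n + 2) → Prop} (hx : ∀ i, P (Fin.castAdd 2 i))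
    (hy : P (Fin.natAdd n 0)) (hz : P (Fin.natAdd n 1)) : ∀ i, P i :=
  Fin.addCases hx (by intro i; fin_cases i; exacts [hy, hz])

/-- The homomorphism from polynomials to Laurent polynomials that expresses `y` on the
hypersurface `u² y + z² + α u = c` by the other coordinates. -/
noncomputable def toLaurent (α c : ℂ) : PolyRing (n + 2) →ₐ[ℂ] Laurent n :=
  aeval (coords (fun i => mono (expX i)) (laurentY α c) (mono expZ))

lemma toLaurent_x (α c : ℂ) (i : Fin n) :
    toLaurent α c (X (Fin.castAdd 2 i)) = mono (expX i) := by simp [toLaurent]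

lemma toLaurent_y (α c : ℂ) : toLaurent α c (yVar n) = laurentY α c := by simp [toLaurent, yVar]

lemma toLaurent_z (α c : ℂ) : toLaurent α c (zVar n) = mono expZ := by simp [toLaurent, zVar]

lemma mono_prod (s : Finset (Fin n)) (v : Fin n → Expo n) :
    ∏ i ∈ s, mono (v i) = mono (∑ i ∈ s, v i) := by
  classical
  induction s using Finset.induction_on with
  | empty => simp [mono_zero]
  | insert i s hi ih => rw [Finset.prod_insert hi, Finset.sum_insert hi, mono_add, ih]

lemma expo_sum_apply {ι : Type*} (s : Finset ι) (v : ι → Expo n) (i : Fin (n + 1)) :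
    (∑ j ∈ s, v j) i = ∑ j ∈ s, v j i := by
  classical
  induction s using Finset.induction_on with
  | empty => simp
  | insert j s hj ih => rw [Finset.sum_insert hj, Finset.sum_insert hj, expo_add_apply, ih]

lemma sum_expX : ∑ i : Fin n, expX i = (expU : Expo n) := by
  apply expo_ext
  · simp [expo_sum_apply]
  · intro i; simp [expo_sum_apply]

lemma toLaurent_xProd (α c : ℂ) : toLaurent α c (xProd n) = mono expU := by
  rw [xProd, map_prod]
  simp only [toLaurent_x]
  rw [mono_prod, sum_expX]

/-- The coordinate ring of `u² y + z² + α u = c`, as a ring of Laurent polynomials. -/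
noncomputable def coordRing (n : ℕ) (α c : ℂ) : Subalgebra ℂ (Laurent n) :=
  (toLaurent (n := n) α c).range

variable {α c : ℂ}

lemma mono_expX_mem (i : Fin n) : mono (expX i) ∈ coordRing n α c := ⟨_, toLaurent_x α c i⟩

lemma laurentY_mem : laurentY α c ∈ coordRing n α c := ⟨_, toLaurent_y α c⟩

lemma mono_expZ_mem : mono expZ ∈ coordRing n α c := ⟨_, toLaurent_z α c⟩

lemma mono_expU_mem : mono expU ∈ coordRing n α c := ⟨_, toLaurent_xProd α c⟩

lemma expo_eq_sum (v : Expo n) : v = v 0 • expZ + ∑ i : Fin n, v i.succ • expX i := by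
  apply expo_ext
  · simp [expo_sum_apply]
  · intro i; simp [expo_sum_apply]

lemma mono_mem_of_nonneg {v : Expo n} (hv : ∀ i, 0 ≤ v i) : mono v ∈ coordRing n α c := by
  have : v = (v 0).toNat • expZ + ∑ i : Fin n, (v i.succ).toNat • expX i := by
    conv_lhs => rw [expo_eq_sum v]
    congr 1
    · rw [← natCast_zsmul, Int.toNat_of_nonneg (hv 0)]
    · refine Finset.sum_congr rfl fun i _ => ?_
      rw [← natCast_zsmul, Int.toNat_of_nonneg (hv _)]
  rw [this, mono_add, mono_nsmul, ← mono_prod]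
  refine mul_mem (pow_mem mono_expZ_mem _) (prod_mem fun i _ => ?_)
  rw [mono_nsmul]
  exact pow_mem (mono_expX_mem i) _

lemma laurent_eq_sum (f : Laurent n) :
    f = ∑ v ∈ f.coeff.support, algebraMap ℂ (Laurent n) (f.coeff v) * mono v := by
  conv_lhs => rw [← AddMonoidAlgebra.sum_coeff_single f, Finsupp.sum]
  refine Finset.sum_congr rfl fun v _ => ?_
  simp [mono, AddMonoidAlgebra.coe_algebraMap, AddMonoidAlgebra.single_mul_single]

lemma mem_of_nonneg {f : Laurent n} (hf : ∀ v, f.coeff v ≠ 0 → ∀ i, 0 ≤ v i) :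
    f ∈ coordRing n α c := by
  rw [laurent_eq_sum f]
  exact sum_mem fun v hv => mul_mem (Subalgebra.algebraMap_mem _ _)
    (mono_mem_of_nonneg (hf v (Finsupp.mem_support_iff.mp hv)))

/-- The elements `x^p y^j z^ε` with `ε ∈ {0, 1}`, which span the coordinate ring. -/
noncomputable def normalForm (α c : ℂ) (s : (Fin n → ℕ) × ℕ × Fin 2) : Laurent n :=
  mono (toLex (Fin.cons 0 fun i => (s.1 i : ℤ))) * laurentY α c ^ s.2.1 *
    mono expZ ^ (s.2.2 : ℕ)

/-- The leading exponent of `x^p y^j z^ε`. -/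
def normalExpo (s : (Fin n → ℕ) × ℕ × Fin 2) : Expo n :=
  toLex (Fin.cons (2 * s.2.1 + (s.2.2 : ℕ) : ℤ) fun i => (s.1 i : ℤ) - 2 * s.2.1)

lemma normalExpo_zero (s : (Fin n → ℕ) × ℕ × Fin 2) :
    normalExpo s 0 = 2 * s.2.1 + (s.2.2 : ℕ) := rfl

lemma normalExpo_succ (s : (Fin n → ℕ) × ℕ × Fin 2) (i : Fin n) :
    normalExpo s i.succ = (s.1 i : ℤ) - 2 * s.2.1 := rfl

lemma normalExpo_injective : Function.Injective (normalExpo (n := n)) := by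
  rintro ⟨p, j, ε⟩ ⟨p', j', ε'⟩ h
  have h0 := congrFun h 0
  have h0' : (2 * j + (ε : ℕ) : ℤ) = 2 * j' + (ε' : ℕ) := h0
  have hj : j = j' := by omega
  have hε : ε = ε' := by ext; omega
  subst hj hε
  have : p = p' := by
    funext i
    have hi : (p i : ℤ) - 2 * j = p' i - 2 * j := congrFun h i.succ
    omega
  rw [this]

lemma hasLead_normalForm (s : (Fin n → ℕ) × ℕ × Fin 2) :
    HasLead (normalForm α c s) (normalExpo s) ((-1) ^ s.2.1) := by
  have h := ((hasLead_mono (toLex (Fin.cons 0 fun i => (s.1 i : ℤ)) : Expo n)).mul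
    ((hasLead_laurentY α c).pow s.2.1)).mul ((hasLead_mono expZ).pow (s.2.2 : ℕ))
  convert h using 1
  · rfl
  · apply expo_ext
    · simp [normalExpo_zero]; ring
    · intro i; simp [normalExpo_succ]; ring
  · simp

lemma mem_span_normalForm (f : PolyRing (n + 2)) :
    toLaurent α c f ∈ Submodule.span ℂ (Set.range (normalForm (n := n) α c)) := by
  have hstep : ∀ g : Laurent n, (∀ s, normalForm α c s * g ∈
      Submodule.span ℂ (Set.range (normalForm (n := n) α c))) →
      ∀ h ∈ Submodule.span ℂ (Set.range (normalForm (n := n) α c)),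
        h * g ∈ Submodule.span ℂ (Set.range (normalForm (n := n) α c)) := by
    intro g hg h hh
    induction hh using Submodule.span_induction with
    | mem x hx => obtain ⟨s, rfl⟩ := hx; exact hg s
    | zero => simp
    | add x y _ _ hx hy => rw [add_mul]; exact add_mem hx hy
    | smul a x _ hx => rw [smul_mul_assoc]; exact Submodule.smul_mem _ _ hx
  have hX : ∀ v : Expo n, v 0 = 0 → (∀ i, 0 ≤ v i) →
      ∀ h ∈ Submodule.span ℂ (Set.range (normalForm (n := n) α c)),
        h * mono v ∈ Submodule.span ℂ (Set.range (normalForm (n := n) α c)) := by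
    intro v hv0 hv
    refine hstep _ fun s => Submodule.subset_span ⟨(fun i => s.1 i + (v i.succ).toNat, s.2), ?_⟩
    have : (toLex (Fin.cons 0 fun i => ((s.1 i + (v i.succ).toNat : ℕ) : ℤ)) : Expo n) =
        toLex (Fin.cons 0 fun i => (s.1 i : ℤ)) + v := by
      apply expo_ext
      · simp [hv0]
      · intro i; simp [hv i.succ]
    simp only [normalForm, this, mono_add]
    ring
  have hY : ∀ h ∈ Submodule.span ℂ (Set.range (normalForm (n := n) α c)),
      h * laurentY α c ∈ Submodule.span ℂ (Set.range (normalForm (n := n) α c)) := by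
    refine hstep _ fun s => Submodule.subset_span ⟨(s.1, s.2.1 + 1, s.2.2), ?_⟩
    simp only [normalForm, pow_succ]
    ring
  induction f using MvPolynomial.induction_on with
  | C a =>
    rw [← MvPolynomial.algebraMap_eq, AlgHom.commutes, Algebra.algebraMap_eq_smul_one]
    refine Submodule.smul_mem _ _ (Submodule.subset_span ⟨(0, 0, 0), ?_⟩)
    have : (toLex (Fin.cons 0 fun _ => (0 : ℤ)) : Expo n) = 0 :=
      expo_ext rfl fun _ => rfl
    simp [normalForm, this, mono_zero]
  | add p q hp hq => rw [map_add]; exact add_mem hp hq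
  | mul_X p i hp =>
    rw [map_mul]
    revert i
    refine forall_coords (fun i => ?_) ?_ ?_
    · rw [toLaurent_x]
      exact hX _ (by simp) (Fin.cases (by simp) (by intro j; simp; split_ifs <;> simp)) _ hp
    · exact (toLaurent_y (n := n) α c) ▸ hY _ hp
    · change _ * toLaurent α c (zVar n) ∈ _
      rw [toLaurent_z]
      refine hstep _ ?_ _ hp
      rintro ⟨p, j, ε⟩
      fin_cases ε
      · refine Submodule.subset_span ⟨(p, j, 1), ?_⟩
        simp [normalForm]
      · -- `z² = c - α u - u² y`
        have hz : normalForm α c (p, j, 1) * mono expZ = c • normalForm α c (p, j, 0) -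
            α • (normalForm α c (p, j, 0) * mono expU) -
            normalForm α c (p, j, 0) * laurentY α c * mono (2 • expU) := by
          have := laurentY_spec (n := n) α c
          rw [mono_nsmul]
          simp only [normalForm, Algebra.smul_def]
          simp only [Fin.isValue, Fin.val_one, Fin.val_zero, pow_one, pow_zero, mul_one]
          linear_combination (mono (toLex (Fin.cons 0 fun i => (p i : ℤ)) : Expo n) *
            laurentY α c ^ j) * this
        change normalForm α c (p, j, 1) * mono expZ ∈ _
        rw [hz]
        have hs : normalForm α c (p, j, 0) ∈
            Submodule.span ℂ (Set.range (normalForm (n := n) α c)) :=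
          Submodule.subset_span ⟨_, rfl⟩
        refine sub_mem (sub_mem (Submodule.smul_mem _ _ hs) (Submodule.smul_mem _ _ ?_)) ?_
        · exact hX _ (by simp) (Fin.cases (by simp) (by simp)) _ hs
        · exact hX _ (by simp) (Fin.cases (by simp) (by simp)) _ (hY _ hs)

/-- The exponents that lead an element of the coordinate ring. -/
def LeadExpo (v : Expo n) : Prop := 0 ≤ v 0 ∧ ∀ i : Fin n, 0 ≤ v i.succ + 2 * (v 0 / 2)

lemma exists_normalForm {f : Laurent n} (hf : f ∈ coordRing n α c) (hf0 : f ≠ 0) :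
    ∃ s a, a ≠ 0 ∧ HasLead f (normalExpo s) a ∧
      f ∈ Submodule.span ℂ (normalForm α c '' {t | normalExpo t ≤ normalExpo s}) := by
  obtain ⟨g, rfl⟩ := hf
  exact exists_lead_of_mem_span normalExpo_injective (fun s => by simp) hasLead_normalForm
    (mem_span_normalForm g) hf0

lemma leadExpo_of_hasLead {f : Laurent n} (hf : f ∈ coordRing n α c) {v : Expo n} {a : ℂ}
    (hv : HasLead f v a) (ha : a ≠ 0) : LeadExpo v := by
  obtain ⟨s, b, hb, hs, -⟩ := exists_normalForm hf (by rintro rfl; exact ha (by simp [← hv.1]))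
  rw [hv.unique hs ha hb]
  refine ⟨by rw [normalExpo_zero]; omega, fun i => ?_⟩
  rw [normalExpo_zero, normalExpo_succ]
  have := s.2.2.isLt
  omega

lemma exists_hasLead_of_leadExpo {v : Expo n} (hv : LeadExpo v) :
    ∃ f ∈ coordRing n α c, ∃ a : ℂ, a ≠ 0 ∧ HasLead f v a := by
  let s : (Fin n → ℕ) × ℕ × Fin 2 := (fun i => (v i.succ + 2 * (v 0 / 2)).toNat,
    (v 0 / 2).toNat, ⟨(v 0 % 2).toNat, by omega⟩)
  have h0 := hv.1
  have hs : normalExpo s = v := by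
    apply expo_ext
    · rw [normalExpo_zero]; simp only [s]; omega
    · intro i
      have := hv.2 i
      rw [normalExpo_succ]; simp only [s]; omega
  refine ⟨normalForm α c s, ?_, (-1) ^ s.2.1, by simp, hs ▸ hasLead_normalForm s⟩
  exact mul_mem (mul_mem (mono_mem_of_nonneg (Fin.cases (by simp) (by simp)))
    (pow_mem laurentY_mem _)) (pow_mem mono_expZ_mem _)

/-- An element of the coordinate ring of degree at most one in `z` is a polynomial in the `xᵢ`
and `z`. -/
lemma nonneg_of_zDegree_le_one {f : Laurent n} (hf : f ∈ coordRing n α c)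
    (h1 : ∀ v, f.coeff v ≠ 0 → v 0 ≤ 1) : ∀ v, f.coeff v ≠ 0 → ∀ i, 0 ≤ v i := by
  rcases eq_or_ne f 0 with rfl | hf0
  · intro v hv; simp at hv
  obtain ⟨s, b, hb, hs, hmem⟩ := exists_normalForm hf hf0
  have hs1 : normalExpo s 0 ≤ 1 := h1 _ (by rw [hs.1]; exact hb)
  clear hf hf0 h1 hs
  induction hmem using Submodule.span_induction with
  | mem x hx =>
    obtain ⟨t, ht, rfl⟩ := hx
    have ht1 := (expo_zero_le_of_le ht).trans hs1
    rw [normalExpo_zero] at ht1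
    have hj : t.2.1 = 0 := by omega
    intro v hv
    rw [normalForm, hj, pow_zero, mul_one, ← mono_nsmul, ← mono_add, mono,
      AddMonoidAlgebra.coeff_single, Finsupp.single_apply_ne_zero] at hv
    rw [hv.1]
    exact Fin.cases (by simp) (by simp)
  | zero => intro v hv; simp at hv
  | add x y _ _ hx hy =>
    intro v hv
    by_cases hxv : x.coeff v = 0
    · exact hy v (by intro h; exact hv (by simp [hxv, h]))
    · exact hx v hxv
  | smul a x _ hx =>
    intro v hv
    exact hx v (by intro h; exact hv (by simp [h]))

lemma zDegree_nonneg {f : Laurent n} (hf : f ∈ coordRing n α c) :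
    ∀ v, f.coeff v ≠ 0 → 0 ≤ v 0 := by
  let B : Submodule ℂ (Laurent n) :=
    { carrier := {f | ∀ v, f.coeff v ≠ 0 → 0 ≤ v 0}
      zero_mem' := by intro v hv; simp at hv
      add_mem' := by
        intro x y hx hy v hv
        by_cases hxv : x.coeff v = 0
        · exact hy v (by intro h; exact hv (by simp [hxv, h]))
        · exact hx v hxv
      smul_mem' := by
        intro a x hx v hv
        exact hx v (by intro h; exact hv (by simp [h])) }
  have hmono : ∀ w : Expo n, 0 ≤ w 0 → ∀ f ∈ B, mono w * f ∈ B := by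
    intro w hw f hf v hv
    rw [coeff_mono_mul] at hv
    have := hf _ hv
    simp at this; omega
  have hY : ∀ f ∈ B, laurentY α c * f ∈ B := by
    intro f hf
    rw [laurentY, mul_assoc, sub_mul, sub_mul, ← mono_nsmul, mul_assoc, ← Algebra.smul_def,
      ← Algebra.smul_def]
    exact hmono _ (by simp) _ (sub_mem (sub_mem (Submodule.smul_mem _ _ hf)
      (hmono _ (by simp) _ hf)) (Submodule.smul_mem _ _ (hmono _ (by simp) _ hf)))
  obtain ⟨g, rfl⟩ := hf
  change toLaurent α c g ∈ B
  induction g using MvPolynomial.induction_on with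
  | C a =>
    rw [← MvPolynomial.algebraMap_eq, AlgHom.commutes, Algebra.algebraMap_eq_smul_one]
    refine Submodule.smul_mem _ _ ?_
    intro v hv
    rw [← mono_zero, mono, AddMonoidAlgebra.coeff_single, Finsupp.single_apply_ne_zero] at hv
    rw [hv.1]; simp
  | add p q hp hq => rw [map_add]; exact add_mem hp hq
  | mul_X p i hp =>
    rw [map_mul, mul_comm]
    revert i
    refine forall_coords (fun i => ?_) ?_ ?_
    · rw [toLaurent_x]; exact hmono _ (by simp) _ hp
    · exact (toLaurent_y (n := n) α c) ▸ hY _ hp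
    · exact (toLaurent_z (n := n) α c) ▸ hmono _ (by simp) _ hp

/-! ### Locally nilpotent derivations of the coordinate ring -/

lemma addMonoidHom_eq_sum {G : Type*} [AddCommGroup G] (T : Expo n →+ G) (v : Expo n) :
    T v = v 0 • T expZ + ∑ i : Fin n, v i.succ • T (expX i) := by
  conv_lhs => rw [expo_eq_sum v]
  rw [map_add, map_sum, map_zsmul]
  simp only [map_zsmul]

lemma exists_common_lead {T : Expo n →+ Laurent n} (hT : T ≠ 0) :
    ∃ (e : Expo n) (l : Expo n →+ ℂ), (∀ v, HasLead (T v) e (l v)) ∧ l ≠ 0 := by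
  classical
  let s : Finset (Expo n) := (T expZ).coeff.support ∪
    Finset.univ.biUnion fun i : Fin n => (T (expX i)).coeff.support
  have hs : s.Nonempty := by
    by_contra h
    rw [Finset.not_nonempty_iff_eq_empty, Finset.eq_empty_iff_forall_notMem] at h
    simp only [s, Finset.mem_union, Finset.mem_biUnion, Finset.mem_univ, true_and, not_or,
      not_exists, Finsupp.notMem_support_iff] at h
    apply hT
    ext v : 1
    have h1 : T expZ = 0 := laurent_ext fun w => (h w).1
    have h2 : ∀ i, T (expX i) = 0 := fun i => laurent_ext fun w => (h w).2 i
    rw [addMonoidHom_eq_sum, h1]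
    simp [h2]
  set e := s.max' hs with he
  have hgt : ∀ w, e < w → w ∉ s := fun w hw h => absurd (Finset.le_max' s w h) (not_le.mpr hw)
  have hcoeff : ∀ w v, (T v).coeff w =
      v 0 • (T expZ).coeff w + ∑ i : Fin n, v i.succ • (T (expX i)).coeff w := by
    intro w v
    let ev : Laurent n →+ ℂ :=
      (Finsupp.applyAddHom w).comp (AddMonoidAlgebra.coeffAddEquiv).toAddMonoidHom
    exact addMonoidHom_eq_sum (ev.comp T) v
  refine ⟨e, ((Finsupp.applyAddHom e).comp
    (AddMonoidAlgebra.coeffAddEquiv).toAddMonoidHom).comp T, fun v => ⟨rfl, fun w hw => ?_⟩, ?_⟩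
  · have := hgt w hw
    simp only [s, Finset.mem_union, Finset.mem_biUnion, Finset.mem_univ, true_and, not_or,
      not_exists, Finsupp.notMem_support_iff] at this
    rw [hcoeff, this.1]
    simp [this.2]
  · intro h
    have hz : ∀ v, (T v).coeff e = 0 := fun v => DFunLike.congr_fun h v
    have := Finset.max'_mem s hs
    rw [← he] at this
    simp [s, hz] at this

/-- The leading part of a nonzero locally nilpotent derivation of the coordinate ring kills every
`xᵢ` and lowers the degree in `z` by one. If it did not kill `xᵢ`, then it would not kill `z`
either, and `xᵢ + e`, `z + e` would be leading exponents, where `e` is the exponent of the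
derivation. This forces `2 e` to be a leading exponent, on which local nilpotency fails. -/
lemma lead_of_locallyNilpotent {T : Expo n →+ Laurent n} (hT : T ≠ 0)
    (hA : ∀ f ∈ coordRing n α c, expDerivation T f ∈ coordRing n α c)
    (hnil : ∀ f ∈ coordRing n α c, ∃ k, (expDerivation T)^[k] f = 0) :
    ∃ (e : Expo n) (l : Expo n →+ ℂ), (∀ v, HasLead (T v) e (l v)) ∧
      (∀ i, l (expX i) = 0) ∧ e 0 = -1 ∧ l expZ ≠ 0 := by
  obtain ⟨e, l, hl, hl0⟩ := exists_common_lead hT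
  have hS : ∀ v, LeadExpo v → ∃ k : ℕ, l v = -(k * l e) := by
    intro v hv
    obtain ⟨f, hf, a, ha, hfa⟩ := exists_hasLead_of_leadExpo (α := α) (c := c) hv
    obtain ⟨k, hk⟩ := hnil f hf
    obtain ⟨i, hi⟩ := exists_nat_of_iterate_eq_zero hl hfa ha hk
    exact ⟨i, eq_neg_of_add_eq_zero_left hi⟩
  have hS' : ∀ v, LeadExpo v → l v ≠ 0 → LeadExpo (v + e) := by
    intro v hv hlv
    obtain ⟨f, hf, a, ha, hfa⟩ := exists_hasLead_of_leadExpo (α := α) (c := c) hv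
    exact leadExpo_of_hasLead (hA f hf) (expDerivation_hasLead hl hfa) (mul_ne_zero hlv ha)
  have hX : ∀ i : Fin n, LeadExpo (expX i) := fun i =>
    ⟨by simp, fun j => by simp; split_ifs <;> simp⟩
  have hZ : LeadExpo (expZ : Expo n) := ⟨by simp, fun j => by simp⟩
  have hY : LeadExpo (2 • expZ - 2 • expU : Expo n) := ⟨by simp, fun j => by simp⟩
  have hle : l e ≠ 0 := by
    intro h0
    apply hl0
    ext v
    have h1 : ∀ w, LeadExpo w → l w = 0 := fun w hw => by
      obtain ⟨k, hk⟩ := hS w hw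
      simpa [h0] using hk
    rw [addMonoidHom_eq_sum l v, h1 _ hZ]
    simp [h1 _ (hX _)]
  have h2e : ¬ LeadExpo (2 • e) := by
    intro h
    obtain ⟨k, hk⟩ := hS _ h
    have h2 : ((2 + k : ℕ) : ℂ) * l e = 0 := by
      rw [map_nsmul, nsmul_eq_mul] at hk
      push_cast at hk ⊢
      linear_combination hk
    rcases mul_eq_zero.mp h2 with h3 | h3
    · exact absurd (Nat.cast_eq_zero.mp h3) (by omega)
    · exact hle h3
  have hx0 : ∀ i, l (expX i) = 0 := by
    intro i
    by_contra hi
    choose a ha using fun j => hS _ (hX j)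
    obtain ⟨b, hb⟩ := hS _ hZ
    obtain ⟨d, hd⟩ := hS _ hY
    have hU : l expU = -((∑ j, (a j : ℂ)) * l e) := by
      rw [← sum_expX, map_sum, Finset.sum_mul, ← Finset.sum_neg_distrib]
      exact Finset.sum_congr rfl fun j _ => ha j
    have hd' : (d : ℂ) = 2 * b - 2 * ∑ j, (a j : ℂ) := by
      rw [map_sub, map_nsmul, map_nsmul, hb, hU] at hd
      simp only [nsmul_eq_mul] at hd
      apply mul_right_cancel₀ hle
      push_cast at hd
      linear_combination hd
    have hd'' : (d + 2 * ∑ j, a j : ℕ) = 2 * b := by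
      have : ((d + 2 * ∑ j, a j : ℕ) : ℂ) = ((2 * b : ℕ) : ℂ) := by
        push_cast
        linear_combination hd'
      exact_mod_cast this
    have hai : a i ≠ 0 := by
      intro h
      exact hi (by rw [ha i, h]; simp)
    have hsum : a i ≤ ∑ j, a j := Finset.single_le_sum (fun _ _ => Nat.zero_le _)
      (Finset.mem_univ i)
    have hb0 : b ≠ 0 := by omega
    have hz : l expZ ≠ 0 := by
      rw [hb]
      exact neg_ne_zero.mpr (mul_ne_zero (Nat.cast_ne_zero.mpr hb0) hle)
    obtain ⟨h1, h2⟩ := hS' _ (hX i) hi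
    obtain ⟨h3, h4⟩ := hS' _ hZ hz
    simp only [expo_add_apply, expX_zero, expX_succ, expZ_zero, expZ_succ, zero_add] at h1 h2 h3 h4
    refine h2e ⟨?_, fun j => ?_⟩
    · rw [expo_nsmul_apply]; push_cast; omega
    · have h5 := h2 j
      have h6 := h4 j
      simp only [expo_nsmul_apply]
      push_cast
      split_ifs at h5 <;> omega
  refine ⟨e, l, hl, hx0, ?_, ?_⟩
  all_goals
    obtain ⟨b, hb⟩ := hS _ hZ
    have hl' := addMonoidHom_eq_sum l e
    simp only [hx0, smul_zero, Finset.sum_const_zero, add_zero] at hl'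
    rw [hb, zsmul_eq_mul] at hl'
    have hb1 : e 0 * (b : ℤ) = -1 := by
      have : ((e 0 * (b : ℤ) : ℤ) : ℂ) = ((-1 : ℤ) : ℂ) := by
        apply mul_right_cancel₀ hle
        push_cast
        linear_combination hl'
      exact_mod_cast this
  · rcases Int.isUnit_iff.mp (IsUnit.of_mul_eq_one (-(b : ℤ)) (by linarith)) with h | h
    · rw [h] at hb1; omega
    · exact h
  · rw [hb]
    refine neg_ne_zero.mpr (mul_ne_zero (Nat.cast_ne_zero.mpr ?_) hle)
    rintro rfl
    simp at hb1

/-- A Laurent polynomial that is a polynomial in `x₁, …, xₙ`. -/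
def IsXPoly (f : Laurent n) : Prop := ∀ v, f.coeff v ≠ 0 → v 0 = 0 ∧ ∀ i, 0 ≤ v i

lemma IsXPoly.mem {f : Laurent n} (hf : IsXPoly f) : f ∈ coordRing n α c :=
  mem_of_nonneg fun v hv => (hf v hv).2

lemma isXPoly_of_hasLead {f : Laurent n} (hf : f ∈ coordRing n α c) {v : Expo n} {a : ℂ}
    (hv : HasLead f v a) (hv0 : v 0 = 0) : IsXPoly f := by
  have h0 : ∀ w, f.coeff w ≠ 0 → w 0 ≤ 0 := fun w hw => hv0 ▸ expo_zero_le_of_le (hv.le hw)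
  intro w hw
  have h := nonneg_of_zDegree_le_one hf (fun w hw => (h0 w hw).trans zero_le_one) w hw
  exact ⟨le_antisymm (h0 w hw) (h 0), h⟩

/-- The kernel of a nonzero locally nilpotent derivation of the coordinate ring consists of
polynomials in the `xᵢ`. -/
lemma isXPoly_of_expDerivation_eq_zero {T : Expo n →+ Laurent n} {e : Expo n} {l : Expo n →+ ℂ}
    (hl : ∀ v, HasLead (T v) e (l v)) (hx : ∀ i, l (expX i) = 0) (hz : l expZ ≠ 0)
    {f : Laurent n} (hf : f ∈ coordRing n α c) (h : expDerivation T f = 0) : IsXPoly f := by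
  rcases eq_or_ne f 0 with rfl | hf0
  · intro v hv; simp at hv
  obtain ⟨v, a, ha, hv⟩ := exists_hasLead hf0
  have h1 := (expDerivation_hasLead hl hv).1
  rw [h] at h1
  have h2 : l v = 0 := (mul_eq_zero.mp h1.symm).resolve_right ha
  rw [addMonoidHom_eq_sum l v] at h2
  simp only [hx, smul_zero, Finset.sum_const_zero, add_zero, zsmul_eq_mul, mul_eq_zero, hz,
    or_false] at h2
  exact isXPoly_of_hasLead hf hv (by exact_mod_cast h2)

variable {α' c' : ℂ}

/-! ### Isomorphisms of the coordinate rings -/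

lemma expDerivation_mono (T : Expo n →+ Laurent n) (v : Expo n) :
    expDerivation T (mono v) = T v * mono v := expDerivation_single T v 1

lemma expDerivation_mulLeft (T : Expo n →+ Laurent n) (g f : Laurent n) :
    expDerivation ((AddMonoidHom.mulLeft g).comp T) f = g * expDerivation T f := by
  induction f using AddMonoidAlgebra.induction_linear with
  | zero => simp
  | add f h hf hh => rw [map_add, map_add, hf, hh, mul_add]
  | single v a => simp [expDerivation_single, mul_assoc]

/-- The logarithmic form of `u² ∂/∂z`. -/
noncomputable def zShift : Expo n →+ Laurent n :=
  AddMonoidHom.mk' (fun v => v 0 • mono (2 • expU - expZ)) (by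
    intro v w; rw [expo_add_apply, add_smul])

/-- The locally nilpotent derivation `u² ∂/∂z - (2 z) ∂/∂y` of the coordinate rings. -/
noncomputable def sliceDer : Derivation ℂ (Laurent n) (Laurent n) := expDerivation zShift

lemma sliceDer_mono (v : Expo n) :
    sliceDer (mono v) = v 0 • mono (v + (2 • expU - expZ)) := by
  rw [sliceDer, expDerivation_mono, mono_add]
  simp only [zShift, AddMonoidHom.mk'_apply, zsmul_eq_mul]
  ring

lemma sliceDer_z : sliceDer (mono (expZ : Expo n)) = mono expU ^ 2 := by
  rw [sliceDer_mono, expZ_zero, one_smul, ← mono_nsmul]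
  congr 1; abel

lemma coeff_sliceDer (f : Laurent n) (w : Expo n) :
    (sliceDer f).coeff w = (w 0 + 1) * f.coeff (w - (2 • expU - expZ)) := by
  induction f using AddMonoidAlgebra.induction_linear with
  | zero => simp
  | add f h hf hh =>
    rw [map_add, AddMonoidAlgebra.coeff_add, AddMonoidAlgebra.coeff_add, Finsupp.add_apply,
      Finsupp.add_apply, hf, hh, mul_add]
  | single v a =>
    have h1 : (AddMonoidAlgebra.single v a : Laurent n) = a • mono v := by simp [mono]
    rw [h1, Derivation.map_smul, sliceDer_mono, AddMonoidAlgebra.coeff_smul, AddMonoidAlgebra.coeff_smul,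
      AddMonoidAlgebra.coeff_smul, mono, mono, AddMonoidAlgebra.coeff_single,
      AddMonoidAlgebra.coeff_single, Finsupp.smul_apply, Finsupp.smul_apply, Finsupp.smul_apply]
    by_cases h : w = v + (2 • expU - expZ)
    · subst h
      simp
      ring
    · rw [Finsupp.single_eq_of_ne h, Finsupp.single_eq_of_ne (fun h' => h (by rw [← h']; abel))]
      simp

lemma IsXPoly.sliceDer_eq_zero {f : Laurent n} (hf : IsXPoly f) : sliceDer f = 0 := by
  refine laurent_ext fun w => ?_
  rw [coeff_sliceDer]
  by_cases h : f.coeff (w - (2 • expU - expZ)) = 0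
  · rw [h, mul_zero]; rfl
  · have h0 := (hf _ h).1
    simp only [expo_sub_apply, expo_nsmul_apply, expU_zero, expZ_zero] at h0
    have : w 0 = -1 := by push_cast at h0; omega
    simp [this]

lemma isXPoly_mono {v : Expo n} (h0 : v 0 = 0) (hv : ∀ i, 0 ≤ v i) : IsXPoly (mono v) := by
  intro w hw
  rw [mono, AddMonoidAlgebra.coeff_single, Finsupp.single_apply_ne_zero] at hw
  rw [hw.1]
  exact ⟨h0, hv⟩

lemma isXPoly_expX (i : Fin n) : IsXPoly (mono (expX i)) :=
  isXPoly_mono (by simp) (Fin.cases (by simp) (by intro j; simp; split_ifs <;> simp))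

lemma isXPoly_expU : IsXPoly (mono (expU : Expo n)) :=
  isXPoly_mono (by simp) (Fin.cases (by simp) (by simp))

lemma isXPoly_expU_sq : IsXPoly (mono (expU : Expo n) ^ 2) := by
  rw [← mono_nsmul]
  exact isXPoly_mono (by simp) (Fin.cases (by simp) (by simp))

lemma mono_ne_zero (v : Expo n) : mono v ≠ 0 := by simp [mono]

lemma mono_mul_cancel {v : Expo n} {f g : Laurent n} (h : mono v * f = mono v * g) : f = g := by
  linear_combination mono (-v) * h - (f - g) * mono_mul_neg v

lemma mono_sq_mul_cancel {v : Expo n} {f g : Laurent n} (h : mono v ^ 2 * f = mono v ^ 2 * g) :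
    f = g := by
  rw [← mono_nsmul] at h
  exact mono_mul_cancel h

lemma sq_expU_mul_derivation_laurentY (d : Derivation ℂ (Laurent n) (Laurent n)) :
    mono expU ^ 2 * d (laurentY α c) = -(2 * mono expZ * d (mono expZ)) -
      (algebraMap ℂ _ α + 2 * mono expU * laurentY α c) * d (mono expU) := by
  have h := congrArg d (laurentY_spec (n := n) α c)
  simp only [map_sub, Derivation.leibniz, Derivation.leibniz_pow, Derivation.map_algebraMap,
    smul_eq_mul, nsmul_eq_mul] at h
  push_cast at h
  linear_combination h

lemma sliceDer_laurentY : sliceDer (laurentY α c : Laurent n) = -(2 * mono expZ) := by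
  apply mono_sq_mul_cancel (v := expU)
  rw [sq_expU_mul_derivation_laurentY, isXPoly_expU.sliceDer_eq_zero, sliceDer_z]
  ring

lemma derivation_mem {d : Derivation ℂ (Laurent n) (Laurent n)}
    (hx : ∀ i, d (mono (expX i)) ∈ coordRing n α c) (hy : d (laurentY α c) ∈ coordRing n α c)
    (hz : d (mono expZ) ∈ coordRing n α c) {f : Laurent n} (hf : f ∈ coordRing n α c) :
    d f ∈ coordRing n α c := by
  obtain ⟨g, rfl⟩ := hf
  change d (toLaurent α c g) ∈ _
  induction g using MvPolynomial.induction_on with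
  | C a =>
    rw [← MvPolynomial.algebraMap_eq, AlgHom.commutes, Derivation.map_algebraMap]
    exact zero_mem _
  | add p q hp hq => rw [map_add, map_add]; exact add_mem hp hq
  | mul_X p i hp =>
    rw [map_mul, Derivation.leibniz]
    refine add_mem (mul_mem ⟨p, rfl⟩ ?_) (mul_mem ⟨_, rfl⟩ hp)
    revert i
    refine forall_coords (fun i => ?_) ?_ ?_
    · rw [toLaurent_x]; exact hx i
    · exact (toLaurent_y (n := n) α c) ▸ hy
    · exact (toLaurent_z (n := n) α c) ▸ hz

lemma sliceDer_mem {f : Laurent n} (hf : f ∈ coordRing n α c) : sliceDer f ∈ coordRing n α c := by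
  refine derivation_mem (fun i => ?_) ?_ ?_ hf
  · rw [(isXPoly_expX i).sliceDer_eq_zero]; exact zero_mem _
  · rw [sliceDer_laurentY]
    exact neg_mem (mul_mem (ofNat_mem _ 2) mono_expZ_mem)
  · rw [sliceDer_z]; exact pow_mem mono_expU_mem _

lemma sliceDer_iterate_mem {f : Laurent n} (hf : f ∈ coordRing n α c) (k : ℕ) :
    sliceDer^[k] f ∈ coordRing n α c := by
  induction k with
  | zero => exact hf
  | succ k ih => rw [Function.iterate_succ_apply']; exact sliceDer_mem ih

lemma exists_sliceDer_iterate_eq_zero {f : Laurent n} (hf : f ∈ coordRing n α c) :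
    ∃ k, sliceDer^[k] f = 0 := by
  have hsupp : ∀ k w, (sliceDer^[k] f).coeff w ≠ 0 →
      f.coeff (w - k • (2 • expU - expZ)) ≠ 0 := by
    intro k
    induction k with
    | zero => intro w hw; simpa using hw
    | succ k ih =>
      intro w hw
      rw [Function.iterate_succ_apply', coeff_sliceDer] at hw
      have := ih _ (right_ne_zero_of_mul hw)
      rwa [sub_sub, ← succ_nsmul'] at this
  obtain ⟨N, hN⟩ := (f.coeff.support.image fun v => v 0).bddAbove
  refine ⟨N.toNat + 1, laurent_ext fun w => ?_⟩
  by_contra hw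
  have h1 := zDegree_nonneg (sliceDer_iterate_mem hf _) w hw
  have h2 := hN (Finset.mem_coe.mpr (Finset.mem_image_of_mem (fun v : Expo n => v 0)
    (Finsupp.mem_support_iff.mpr (hsupp _ w hw))))
  simp only [expo_sub_apply, expo_nsmul_apply, expU_zero, expZ_zero] at h2
  push_cast at h2
  have := Int.self_le_toNat N
  omega

/-- A derivation from the coordinate ring to the Laurent polynomials extends to the Laurent
polynomials. -/
lemma exists_extension (d : coordRing n α c → Laurent n)
    (hadd : ∀ a b, d (a + b) = d a + d b) (hC : ∀ r, d (algebraMap ℂ _ r) = 0)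
    (hmul : ∀ a b, d (a * b) = a * d b + b * d a) :
    ∃ T : Expo n →+ Laurent n, ∀ a : coordRing n α c, expDerivation T (a : Laurent n) = d a := by
  let T : Expo n →+ Laurent n := AddMonoidHom.mk'
    (fun v => v 0 • (mono (-expZ) * d ⟨_, mono_expZ_mem⟩) +
      ∑ i : Fin n, v i.succ • (mono (-expX i) * d ⟨_, mono_expX_mem i⟩)) (by
    intro v w
    simp only [expo_add_apply, add_smul, Finset.sum_add_distrib]
    abel)
  have hTz : expDerivation T (mono expZ) = d ⟨_, mono_expZ_mem⟩ := by
    rw [expDerivation_mono]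
    simp only [T, AddMonoidHom.mk'_apply, expZ_zero, expZ_succ, one_smul, zero_smul,
      Finset.sum_const_zero, add_zero]
    linear_combination (d ⟨_, mono_expZ_mem⟩) * mono_mul_neg (expZ : Expo n)
  have hTx : ∀ i, expDerivation T (mono (expX i)) = d ⟨_, mono_expX_mem i⟩ := by
    intro i
    rw [expDerivation_mono]
    simp only [T, AddMonoidHom.mk'_apply, expX_zero, expX_succ, zero_smul, zero_add, ite_smul,
      one_smul, Finset.sum_ite_eq', Finset.mem_univ, if_true]
    linear_combination (d ⟨_, mono_expX_mem i⟩) * mono_mul_neg (expX i : Expo n)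
  refine ⟨T, ?_⟩
  let G : Subalgebra ℂ (coordRing n α c) :=
    { carrier := {a | expDerivation T a = d a}
      mul_mem' := by
        intro a b ha hb
        change expDerivation T (a * b : Laurent n) = _
        rw [Derivation.leibniz, hmul, smul_eq_mul, smul_eq_mul, ha, hb]
      add_mem' := by
        intro a b ha hb
        change expDerivation T (a + b : Laurent n) = _
        rw [map_add, hadd, ha, hb]
      algebraMap_mem' := by
        intro r
        change expDerivation T (algebraMap ℂ (Laurent n) r) = _
        rw [Derivation.map_algebraMap, hC] }
  have hGz : (⟨_, mono_expZ_mem⟩ : coordRing n α c) ∈ G := hTz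
  have hGx : ∀ i, (⟨_, mono_expX_mem i⟩ : coordRing n α c) ∈ G := hTx
  have hGu : (⟨_, mono_expU_mem⟩ : coordRing n α c) ∈ G := by
    have : (⟨_, mono_expU_mem⟩ : coordRing n α c) = ∏ i : Fin n, ⟨_, mono_expX_mem i⟩ := by
      ext1
      rw [SubmonoidClass.coe_finsetProd]
      simp only [mono_prod, sum_expX]
    rw [this]
    exact prod_mem fun i _ => hGx i
  have hGy : (⟨_, laurentY_mem⟩ : coordRing n α c) ∈ G := by
    have hrel : (⟨_, mono_expU_mem⟩ : coordRing n α c) ^ 2 * ⟨_, laurentY_mem⟩ =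
        algebraMap ℂ _ c - ⟨_, mono_expZ_mem⟩ ^ 2 - algebraMap ℂ _ α * ⟨_, mono_expU_mem⟩ := by
      ext1
      exact laurentY_spec α c
    have h1 : (⟨_, mono_expU_mem⟩ : coordRing n α c) ^ 2 * ⟨_, laurentY_mem⟩ ∈ G := by
      rw [hrel]
      exact sub_mem (sub_mem (G.algebraMap_mem c) (pow_mem hGz 2))
        (mul_mem (G.algebraMap_mem α) hGu)
    have h2 : expDerivation T ((mono expU : Laurent n) ^ 2 * laurentY α c) = _ := h1
    have h3 : expDerivation T ((mono expU : Laurent n) ^ 2) = _ := pow_mem hGu 2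
    rw [hmul, Derivation.leibniz, smul_eq_mul, smul_eq_mul, h3] at h2
    exact mono_sq_mul_cancel (add_right_cancel h2)
  rintro ⟨_, g, rfl⟩
  change (⟨toLaurent α c g, _⟩ : coordRing n α c) ∈ G
  induction g using MvPolynomial.induction_on with
  | C a =>
    convert G.algebraMap_mem a
    ext1
    exact (toLaurent α c).commutes a
  | add p q hp hq =>
    convert add_mem hp hq
    ext1
    exact map_add _ p q
  | mul_X p i hp =>
    have hX : (⟨toLaurent α c (X i), ⟨_, rfl⟩⟩ : coordRing n α c) ∈ G := by
      revert i
      refine forall_coords (fun i => ?_) ?_ ?_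
      · exact (Subtype.ext (toLaurent_x α c i) : (⟨_, _⟩ : coordRing n α c) = ⟨_, _⟩) ▸ hGx i
      · exact (Subtype.ext (toLaurent_y α c) : (⟨_, _⟩ : coordRing n α c) = ⟨_, _⟩) ▸ hGy
      · exact (Subtype.ext (toLaurent_z α c) : (⟨_, _⟩ : coordRing n α c) = ⟨_, _⟩) ▸ hGz
    convert mul_mem hp hX
    ext1
    exact map_mul _ p _

/-- The derivation `sliceDer` of one coordinate ring, transported to another one. -/
noncomputable def transportDer (Ψ : coordRing n α c ≃ₐ[ℂ] coordRing n α' c')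
    (a : coordRing n α' c') : Laurent n :=
  Ψ ⟨sliceDer (Ψ.symm a), sliceDer_mem (Ψ.symm a).2⟩

lemma exists_transport_extension (Ψ : coordRing n α c ≃ₐ[ℂ] coordRing n α' c') :
    ∃ T : Expo n →+ Laurent n, ∀ a : coordRing n α' c', expDerivation T (a : Laurent n) = transportDer Ψ a := by
  apply exists_extension
  · intro a b
    rw [transportDer, transportDer, transportDer, ← Subalgebra.coe_add, ← map_add]
    congr 2
    ext1
    simp
  · intro r
    rw [transportDer]
    have : (⟨sliceDer (Ψ.symm (algebraMap ℂ _ r)), sliceDer_mem (Ψ.symm _).2⟩ :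
        coordRing n α c) = 0 := by
      ext1
      rw [AlgEquiv.commutes]
      exact Derivation.map_algebraMap _ r
    rw [this, map_zero]; rfl
  · intro a b
    have : (⟨sliceDer (Ψ.symm (a * b)), sliceDer_mem (Ψ.symm _).2⟩ : coordRing n α c) =
        Ψ.symm a * ⟨sliceDer (Ψ.symm b), sliceDer_mem (Ψ.symm b).2⟩ +
        Ψ.symm b * ⟨sliceDer (Ψ.symm a), sliceDer_mem (Ψ.symm a).2⟩ := by
      ext1
      simp
    simp only [transportDer]
    rw [this, map_add, map_mul, map_mul]
    simp

/-- The leading part of the transported derivation. -/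
lemma exists_transport_lead (Ψ : coordRing n α c ≃ₐ[ℂ] coordRing n α' c') :
    ∃ (T : Expo n →+ Laurent n) (e : Expo n) (l : Expo n →+ ℂ),
      (∀ a : coordRing n α' c', expDerivation T (a : Laurent n) = transportDer Ψ a) ∧ (∀ v, HasLead (T v) e (l v)) ∧
      (∀ i, l (expX i) = 0) ∧ e 0 = -1 ∧ l expZ ≠ 0 := by
  obtain ⟨T, hT⟩ := exists_transport_extension Ψ
  have hiter : ∀ (k : ℕ) (a : coordRing n α' c'), (expDerivation T)^[k] a =
      Ψ ⟨sliceDer^[k] (Ψ.symm a), sliceDer_iterate_mem (Ψ.symm a).2 k⟩ := by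
    intro k
    induction k with
    | zero => intro a; simp
    | succ k ih =>
      intro a
      rw [Function.iterate_succ_apply', ih, hT, transportDer]
      congr 2
      ext1
      simp [Function.iterate_succ_apply']
  have hT0 : T ≠ 0 := by
    rintro rfl
    have h := hT (Ψ ⟨_, mono_expZ_mem⟩)
    rw [transportDer] at h
    have h0 : expDerivation 0 ((Ψ ⟨_, mono_expZ_mem⟩ : coordRing n α' c') : Laurent n) = 0 := by
      have := expDerivation_mulLeft 0 0 ((Ψ ⟨_, mono_expZ_mem⟩ : coordRing n α' c') : Laurent n)
      simpa using this
    rw [h0] at h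
    have h1 := (map_eq_zero_iff Ψ Ψ.injective).mp (Subtype.ext h.symm)
    have h2 := congrArg Subtype.val h1
    simp only [AlgEquiv.symm_apply_apply] at h2
    rw [sliceDer_z, ← mono_nsmul] at h2
    exact mono_ne_zero _ h2
  have hnil : ∀ f ∈ coordRing n α' c', ∃ k, (expDerivation T)^[k] f = 0 := by
    intro f hf
    obtain ⟨k, hk⟩ := exists_sliceDer_iterate_eq_zero (Ψ.symm ⟨f, hf⟩).2
    refine ⟨k, ?_⟩
    rw [hiter k ⟨f, hf⟩]
    have : (⟨sliceDer^[k] (Ψ.symm ⟨f, hf⟩), sliceDer_iterate_mem (Ψ.symm ⟨f, hf⟩).2 k⟩ :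
        coordRing n α c) = 0 := Subtype.ext hk
    rw [this, map_zero]; rfl
  obtain ⟨e, l, hl⟩ := lead_of_locallyNilpotent hT0
    (fun f hf => by rw [hT ⟨f, hf⟩, transportDer]; exact Subtype.property _) hnil
  exact ⟨T, e, l, hT, hl⟩

lemma isXPoly_map (Ψ : coordRing n α c ≃ₐ[ℂ] coordRing n α' c') {a : coordRing n α c}
    (ha : IsXPoly (a : Laurent n)) : IsXPoly (Ψ a : Laurent n) := by
  obtain ⟨T, e, l, hT, hl, hx, -, hz⟩ := exists_transport_lead Ψ
  refine isXPoly_of_expDerivation_eq_zero hl hx hz (Ψ a).2 ?_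
  rw [hT, transportDer]
  have : (⟨sliceDer (Ψ.symm (Ψ a)), sliceDer_mem (Ψ.symm (Ψ a)).2⟩ : coordRing n α c) = 0 := by
    ext1
    change sliceDer ((Ψ.symm (Ψ a) : coordRing n α c) : Laurent n) = 0
    rw [AlgEquiv.symm_apply_apply, ha.sliceDer_eq_zero]
  rw [this, map_zero]; rfl

/-- An isomorphism of the coordinate rings conjugates the two derivations `sliceDer` up to a
factor in `ℂ[x₁, …, xₙ]`. -/
lemma exists_transport_eq_mul (Ψ : coordRing n α c ≃ₐ[ℂ] coordRing n α' c') :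
    ∃ g : Laurent n, IsXPoly g ∧ ∀ a : coordRing n α' c', transportDer Ψ a = g * sliceDer (a : Laurent n) := by
  obtain ⟨T, e, l, hT, hl, -, he, -⟩ := exists_transport_lead Ψ
  have hTx : ∀ i, T (expX i) = 0 := by
    intro i
    have h1 := hT ⟨_, mono_expX_mem i⟩
    have h2 : (⟨sliceDer (Ψ.symm ⟨_, mono_expX_mem i⟩), sliceDer_mem (Ψ.symm _).2⟩ :
        coordRing n α c) = 0 :=
      Subtype.ext (isXPoly_map Ψ.symm (isXPoly_expX i)).sliceDer_eq_zero
    rw [transportDer, h2, map_zero, expDerivation_mono, mul_comm] at h1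
    exact mono_mul_cancel (h1.trans (mul_zero _).symm)
  have hmem : ∀ f ∈ coordRing n α' c', expDerivation T f ∈ coordRing n α' c' := by
    intro f hf
    rw [hT ⟨f, hf⟩]
    exact Subtype.property _
  -- `h = D z` has degree zero in `z`
  set h := expDerivation T (mono expZ) with hh
  have hX : IsXPoly h := by
    have h1 := expDerivation_hasLead hl (hasLead_mono (expZ : Expo n))
    exact isXPoly_of_hasLead (hmem _ (mono_expZ_mem (α := α') (c := c'))) h1 (by simp [he])
  set g := mono (-(2 • expU)) * h with hg
  have hTg : T = (AddMonoidHom.mulLeft g).comp zShift := by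
    ext v : 1
    rw [addMonoidHom_eq_sum T]
    simp only [hTx, smul_zero, Finset.sum_const_zero, add_zero, AddMonoidHom.comp_apply,
      AddMonoidHom.coe_mulLeft, zShift, AddMonoidHom.mk'_apply, mul_smul_comm]
    congr 1
    rw [hg, hh, expDerivation_mono]
    have h1 : mono (-(2 • expU)) * mono expZ * mono (2 • expU - expZ) = (1 : Laurent n) := by
      rw [← mono_add, ← mono_add, ← mono_zero]
      congr 1; abel
    linear_combination -(T expZ) * h1
  have hD : ∀ f, expDerivation T f = g * sliceDer f := by
    intro f
    rw [hTg, expDerivation_mulLeft, sliceDer]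
  refine ⟨g, ?_, fun a => by rw [← hT, hD]⟩
  -- `D y = -2 z g` lies in the coordinate ring
  have hy := hmem _ (laurentY_mem (α := α') (c := c'))
  rw [hD, sliceDer_laurentY] at hy
  have hgz : mono expZ * g ∈ coordRing n α' c' := by
    have : mono expZ * g = (-1 / 2 : ℂ) • (g * -(2 * mono expZ)) := by
      have h2 : (algebraMap ℂ (Laurent n) (-1 / 2)) * 2 = -1 := by
        rw [← map_ofNat (algebraMap ℂ (Laurent n)) 2, ← map_mul]
        rw [show (-1 / 2 : ℂ) * 2 = -1 by norm_num, map_neg, map_one]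
      rw [Algebra.smul_def]
      linear_combination (g * mono expZ) * h2
    rw [this]
    exact Subalgebra.smul_mem _ hy _
  have hg0 : ∀ v, g.coeff v ≠ 0 → v 0 = 0 := by
    intro v hv
    rw [hg, coeff_mono_mul] at hv
    have := (hX _ hv).1
    simpa using this
  intro v hv
  have h1 := nonneg_of_zDegree_le_one hgz (fun w hw => by
    rw [coeff_mono_mul] at hw
    have := hg0 _ hw
    rw [expo_sub_apply, expZ_zero] at this
    omega) (v + expZ) (by rw [coeff_mono_mul, add_sub_cancel_right]; exact hv)
  refine ⟨hg0 v hv, Fin.cases (hg0 v hv).ge fun i => ?_⟩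
  simpa using h1 i.succ

lemma IsXPoly.const_of_mul_eq_one {f g : Laurent n} (hf : IsXPoly f) (hg : IsXPoly g)
    (h : f * g = 1) : ∃ k : ℂ, k ≠ 0 ∧ f = algebraMap ℂ _ k := by
  have hf0 : f ≠ 0 := by rintro rfl; simp at h
  have hg0 : g ≠ 0 := by rintro rfl; simp at h
  obtain ⟨v, a, ha, hv⟩ := exists_hasLead hf0
  obtain ⟨w, b, hb, hw⟩ := exists_hasLead hg0
  have h1 := hv.mul hw
  rw [h] at h1
  have h2 := h1.unique (hasLead_mono (0 : Expo n)) (mul_ne_zero ha hb) one_ne_zero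
  have hv0 : v = 0 := by
    funext i
    have h3 := (hf v (by rw [hv.1]; exact ha)).2 i
    have h4 := (hg w (by rw [hw.1]; exact hb)).2 i
    have h5 : v i + w i = 0 := congrFun h2 i
    change v i = 0
    omega
  subst hv0
  refine ⟨a, ha, laurent_ext fun x => ?_⟩
  rw [AddMonoidAlgebra.coe_algebraMap, Function.comp, AddMonoidAlgebra.coeff_single]
  by_cases hx : x = 0
  · subst hx
    simp [hv.1]
  · rw [Finsupp.single_eq_of_ne hx]
    by_contra hfx
    have hnn := (hf x hfx).2
    have hle : x ≤ 0 := hv.le hfx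
    have : (0 : Expo n) ≤ x := Pi.toLex_monotone (fun i => hnn i)
    exact hx (le_antisymm hle this)

lemma exists_const_transport (Ψ : coordRing n α c ≃ₐ[ℂ] coordRing n α' c') :
    ∃ k : ℂ, k ≠ 0 ∧ ∀ a : coordRing n α' c',
      transportDer Ψ a = algebraMap ℂ _ k * sliceDer (a : Laurent n) := by
  obtain ⟨g, hgX, hg⟩ := exists_transport_eq_mul Ψ
  obtain ⟨g', hgX', hg'⟩ := exists_transport_eq_mul Ψ.symm
  have hX : IsXPoly (Ψ ⟨g', hgX'.mem⟩ : Laurent n) := isXPoly_map Ψ hgX'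
  have hone : g * (Ψ ⟨g', hgX'.mem⟩ : Laurent n) = 1 := by
    -- both derivations applied to the coordinate `z` of the target
    have h1 := hg ⟨_, mono_expZ_mem⟩
    have h2 := hg' (Ψ.symm ⟨_, mono_expZ_mem⟩)
    rw [transportDer] at h1 h2
    rw [sliceDer_z] at h1
    have h3 := congrArg Ψ (Subtype.ext h2 : (Ψ.symm ⟨_, sliceDer_mem (Ψ.symm.symm _).2⟩ :
      coordRing n α c) = ⟨g', hgX'.mem⟩ *
        ⟨sliceDer (Ψ.symm ⟨_, mono_expZ_mem⟩), sliceDer_mem (Ψ.symm _).2⟩)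
    rw [map_mul, AlgEquiv.apply_symm_apply] at h3
    have h4 := congrArg Subtype.val h3
    simp only [AlgEquiv.symm_symm, AlgEquiv.apply_symm_apply, MulMemClass.coe_mul] at h4
    rw [h1, sliceDer_z] at h4
    apply mono_sq_mul_cancel (v := expU)
    linear_combination -h4
  obtain ⟨k, hk, rfl⟩ := hgX.const_of_mul_eq_one hX hone
  exact ⟨k, hk, hg⟩

/-- An isomorphism of the coordinate rings maps `z` to a polynomial of degree one in `z`, because
it preserves the kernel of the square of the derivation `sliceDer`. -/
lemma exists_map_z (Ψ : coordRing n α c ≃ₐ[ℂ] coordRing n α' c') :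
    ∃ (k : ℂ) (b γ : Laurent n), k ≠ 0 ∧ IsXPoly b ∧ IsXPoly γ ∧
      (Ψ ⟨_, mono_expZ_mem⟩ : Laurent n) = γ + b * mono expZ ∧
      (Ψ (⟨_, mono_expU_mem⟩ ^ 2) : Laurent n) = algebraMap ℂ _ k * b * mono expU ^ 2 := by
  obtain ⟨k, hk, hD⟩ := exists_const_transport Ψ
  set f : Laurent n := (Ψ ⟨_, mono_expZ_mem⟩ : Laurent n) with hf
  have hfA : f ∈ coordRing n α' c' := Subtype.property _
  have h1 : (Ψ (⟨_, mono_expU_mem⟩ ^ 2) : Laurent n) = algebraMap ℂ _ k * sliceDer f := by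
    rw [hf, ← hD, transportDer]
    congr 2
    ext1
    change (mono expU ^ 2 : Laurent n) =
      sliceDer ((Ψ.symm (Ψ ⟨_, mono_expZ_mem⟩) : coordRing n α c) : Laurent n)
    rw [AlgEquiv.symm_apply_apply, sliceDer_z]
  have hX : IsXPoly (Ψ (⟨_, mono_expU_mem⟩ ^ 2) : Laurent n) :=
    isXPoly_map Ψ (a := ⟨_, mono_expU_mem⟩ ^ 2) isXPoly_expU_sq
  -- hence the exponents of `Ψ z` have degree zero or one in `z`
  have hdeg : ∀ v, f.coeff v ≠ 0 → v 0 = 0 ∨ v 0 = 1 := by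
    intro v hv
    by_contra hcon
    rw [not_or] at hcon
    have h2 := (hX (v + (2 • expU - expZ)) (by
      rw [h1, ← Algebra.smul_def, AddMonoidAlgebra.coeff_smul, Finsupp.smul_apply, coeff_sliceDer,
        add_sub_cancel_right, smul_eq_mul]
      refine mul_ne_zero hk (mul_ne_zero ?_ hv)
      simp only [expo_add_apply, expo_sub_apply, expo_nsmul_apply, expU_zero, expZ_zero]
      push_cast
      ring_nf
      exact_mod_cast hcon.1)).1
    simp only [expo_add_apply, expo_sub_apply, expo_nsmul_apply, expU_zero, expZ_zero] at h2
    push_cast at h2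
    exact hcon.2 (by omega)
  have hnn := nonneg_of_zDegree_le_one hfA fun v hv => by rcases hdeg v hv with h | h <;> omega
  set b := mono (-(2 • expU)) * sliceDer f with hb
  have hbc : ∀ w, b.coeff w = (w 0 + 1) * f.coeff (w + expZ) := by
    intro w
    rw [hb, coeff_mono_mul, coeff_sliceDer]
    congr 1
    · simp
    · congr 1; abel
  have hbu : b * mono expU ^ 2 = sliceDer f := by
    rw [hb, ← mono_nsmul]
    linear_combination (sliceDer f) * mono_mul_neg (2 • expU : Expo n)
  refine ⟨k, b, f - b * mono expZ, hk, ?_, ?_, by ring, by rw [h1, mul_assoc, hbu]⟩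
  · intro w hw
    rw [hbc] at hw
    have hw1 := right_ne_zero_of_mul hw
    have hw0 : w 0 = 0 := by
      rcases hdeg _ hw1 with h | h
      · exfalso
        have : w 0 = -1 := by rw [expo_add_apply, expZ_zero] at h; omega
        simp [this] at hw
      · rw [expo_add_apply, expZ_zero] at h; omega
    exact ⟨hw0, Fin.cases hw0.ge fun i => by simpa using hnn _ hw1 i.succ⟩
  · intro w hw
    have h2 : (f - b * mono expZ).coeff w = (1 - w 0) * f.coeff w := by
      rw [AddMonoidAlgebra.coeff_sub, Finsupp.sub_apply, mul_comm b, coeff_mono_mul, hbc,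
        sub_add_cancel, expo_sub_apply, expZ_zero]
      push_cast
      ring
    rw [h2] at hw
    have hw1 := right_ne_zero_of_mul hw
    refine ⟨(hdeg w hw1).resolve_right fun h => ?_, hnn w hw1⟩
    simp [h] at hw

/-- An isomorphism of the coordinate rings maps `u` to `μ u` and `z` to `β z + γ`, with constants
`μ`, `β` and a polynomial `γ` in the `xᵢ` that turns out to be divisible by `u²`. Comparison of the
equations modulo `u²` gives the relations between the parameters. -/
lemma exists_scalars_of_coordRing_equiv (hn : 1 ≤ n)
    (Ψ : coordRing n α c ≃ₐ[ℂ] coordRing n α' c') :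
    ∃ μ β : ℂ, μ ≠ 0 ∧ β ≠ 0 ∧
      (Ψ ⟨_, mono_expU_mem⟩ : Laurent n) = algebraMap ℂ _ μ * mono expU ∧
      c = β ^ 2 * c' ∧ α * μ = β ^ 2 * α' := by
  obtain ⟨k, b, γ, hk, hb, hγ, hz, hu⟩ := exists_map_z Ψ
  obtain ⟨k', b', -, hk', hb', -, -, hu'⟩ := exists_map_z Ψ.symm
  have hconst : (algebraMap ℂ (Laurent n) (k' * k) * b) * (Ψ ⟨b', hb'.mem⟩ : Laurent n) = 1 := by
    have h1 : Ψ.symm (⟨_, mono_expU_mem⟩ ^ 2) =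
        algebraMap ℂ (coordRing n α c) k' * ⟨b', hb'.mem⟩ * ⟨_, mono_expU_mem⟩ ^ 2 :=
      Subtype.ext hu'
    have h2 := congrArg Ψ h1
    rw [AlgEquiv.apply_symm_apply, map_mul, map_mul, AlgEquiv.commutes] at h2
    have h3 : (mono expU ^ 2 : Laurent n) = algebraMap ℂ (Laurent n) k' * Ψ ⟨b', hb'.mem⟩ *
        (Ψ (⟨_, mono_expU_mem⟩ ^ 2) : Laurent n) := congrArg Subtype.val h2
    rw [hu] at h3
    apply mono_sq_mul_cancel (v := expU)
    rw [map_mul]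
    linear_combination -h3
  obtain ⟨β, hβ, rfl⟩ : ∃ β : ℂ, β ≠ 0 ∧ b = algebraMap ℂ _ β := by
    refine hb.const_of_mul_eq_one (g := algebraMap ℂ _ (k' * k) * (Ψ ⟨b', hb'.mem⟩ : Laurent n))
      ?_ (by linear_combination hconst)
    intro v hv
    rw [← Algebra.smul_def, AddMonoidAlgebra.coeff_smul, Finsupp.smul_apply] at hv
    exact isXPoly_map Ψ (a := ⟨b', hb'.mem⟩) hb' v (right_ne_zero_of_mul hv)
  obtain ⟨μ, hμ⟩ : ∃ μ : ℂ, μ ^ 2 = k * β := IsAlgClosed.exists_pow_nat_eq _ two_pos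
  -- a square root of `Ψ (u²) = μ² u²` is `μ u` up to sign
  obtain ⟨μ, hμ, hΨu⟩ : ∃ μ : ℂ, μ ^ 2 = k * β ∧
      (Ψ ⟨_, mono_expU_mem⟩ : Laurent n) = algebraMap ℂ _ μ * mono expU := by
    have h1 : (Ψ ⟨_, mono_expU_mem⟩ : Laurent n) ^ 2 = (algebraMap ℂ _ μ * mono expU) ^ 2 := by
      rw [map_pow] at hu
      rw [mul_pow, ← map_pow, hμ, map_mul]
      exact hu
    rcases sq_eq_sq_iff_eq_or_eq_neg.mp h1 with h | h
    · exact ⟨μ, hμ, h⟩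
    · exact ⟨-μ, by rw [neg_sq, hμ], by rw [h, map_neg, neg_mul]⟩
  refine ⟨μ, β, by rintro rfl; exact mul_ne_zero hk hβ (by rw [← hμ]; simp), hβ, hΨu, ?_⟩
  set Y : Laurent n := (Ψ ⟨_, laurentY_mem⟩ : Laurent n) with hY
  have hYA : Y ∈ coordRing n α' c' := Subtype.property _
  -- the image of the equation of the first hypersurface
  have himage : (algebraMap ℂ _ μ * mono expU) ^ 2 * Y = algebraMap ℂ (Laurent n) c -
      (γ + algebraMap ℂ _ β * mono expZ) ^ 2 - algebraMap ℂ _ α * (algebraMap ℂ _ μ * mono expU) := by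
    have hrel : (⟨_, mono_expU_mem⟩ : coordRing n α c) ^ 2 * ⟨_, laurentY_mem⟩ =
        algebraMap ℂ _ c - ⟨_, mono_expZ_mem⟩ ^ 2 - algebraMap ℂ _ α * ⟨_, mono_expU_mem⟩ :=
      Subtype.ext (laurentY_spec α c)
    have h1 := congrArg Ψ hrel
    simp only [map_mul, map_sub, map_pow, AlgEquiv.commutes] at h1
    rw [← hΨu, ← hz]
    exact congrArg Subtype.val h1
  have heq := laurentY_spec (n := n) α' c'
  set W := algebraMap ℂ (Laurent n) μ ^ 2 * Y - algebraMap ℂ _ β ^ 2 * laurentY α' c' with hW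
  have hWA : W ∈ coordRing n α' c' := sub_mem
    (mul_mem (pow_mem (Subalgebra.algebraMap_mem _ _) _) hYA)
    (mul_mem (pow_mem (Subalgebra.algebraMap_mem _ _) _) laurentY_mem)
  have hUW : mono expU ^ 2 * W = -(2 * algebraMap ℂ _ β * γ * mono expZ) - γ ^ 2 +
      (algebraMap ℂ _ (c - β ^ 2 * c') + algebraMap ℂ _ (β ^ 2 * α' - α * μ) * mono expU) := by
    simp only [map_sub, map_mul, map_pow]
    linear_combination himage - algebraMap ℂ _ β ^ 2 * heq
  have hcoef : ∀ v, (mono expU ^ 2 * W).coeff v = W.coeff (v - 2 • expU) := by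
    intro v
    rw [← mono_nsmul, coeff_mono_mul]
  -- the constant and the linear part have degree zero in `z`
  have hlin : ∀ r s : ℂ, IsXPoly (algebraMap ℂ _ r + algebraMap ℂ _ s * mono (expU : Expo n)) := by
    intro r s v hv
    rw [← Algebra.smul_def, Algebra.algebraMap_eq_smul_one, ← mono_zero] at hv
    rw [AddMonoidAlgebra.coeff_add, Finsupp.add_apply, AddMonoidAlgebra.coeff_smul,
      AddMonoidAlgebra.coeff_smul, Finsupp.smul_apply, Finsupp.smul_apply] at hv
    by_cases h0 : (mono (0 : Expo n)).coeff v = 0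
    · rw [h0, smul_zero, zero_add] at hv
      exact isXPoly_expU v (right_ne_zero_of_mul hv)
    · exact isXPoly_mono rfl (fun _ => le_rfl) v h0
  have hγγ : IsXPoly (γ ^ 2) := by
    intro v hv
    rw [pow_two] at hv
    classical
    have := AddMonoidAlgebra.support_coeff_mul_subset γ γ (Finsupp.mem_support_iff.mpr hv)
    obtain ⟨x, hx, y, hy, rfl⟩ := Finset.mem_add.mp this
    have h1 := hγ x (Finsupp.mem_support_iff.mp hx)
    have h2 := hγ y (Finsupp.mem_support_iff.mp hy)
    exact ⟨by rw [expo_add_apply, h1.1, h2.1, add_zero],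
      fun i => add_nonneg (h1.2 i) (h2.2 i)⟩
  have hcz : ∀ v, (mono expU ^ 2 * W).coeff v ≠ 0 → v 0 ≤ 1 := by
    intro v hv
    by_contra hv1
    apply hv
    have e1 : (γ ^ 2).coeff v = 0 := by
      by_contra h; have := (hγγ v h).1; omega
    have e2 := hlin (c - β ^ 2 * c') (β ^ 2 * α' - α * μ) v
    have e3 : (γ * mono expZ).coeff v = 0 := by
      rw [mul_comm, coeff_mono_mul]
      by_contra h; have := (hγ _ h).1; rw [expo_sub_apply, expZ_zero] at this; omega
    have e4 : (algebraMap ℂ _ (c - β ^ 2 * c') +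
        algebraMap ℂ _ (β ^ 2 * α' - α * μ) * mono (expU : Expo n)).coeff v = 0 := by
      by_contra h; have := (e2 h).1; omega
    have e5 : 2 * algebraMap ℂ _ β * γ * mono expZ = (2 * β) • (γ * mono expZ) := by
      rw [Algebra.smul_def, map_mul, map_ofNat]; ring
    rw [hUW, e5, AddMonoidAlgebra.coeff_add, Finsupp.add_apply, e4, AddMonoidAlgebra.coeff_sub,
      Finsupp.sub_apply, e1, AddMonoidAlgebra.coeff_neg, Finsupp.neg_apply,
      AddMonoidAlgebra.coeff_smul, Finsupp.smul_apply, e3]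
    simp
  have hWnn := nonneg_of_zDegree_le_one hWA fun v hv => by
    have := hcz (v + 2 • expU) (by rw [hcoef, add_sub_cancel_right]; exact hv)
    simpa using this
  -- the coefficient of `z` shows that `u²` divides `γ`
  set γ' := mono (-(2 • expU)) * γ with hγ'
  have hγu : γ = mono expU ^ 2 * γ' := by
    rw [hγ', ← mono_nsmul, ← mul_assoc, mono_mul_neg, one_mul]
  have hγX : IsXPoly γ' := by
    intro v hv
    rw [hγ', coeff_mono_mul, sub_neg_eq_add] at hv
    have hv0 : v 0 = 0 := by simpa using (hγ _ hv).1
    refine ⟨hv0, Fin.cases hv0.ge fun i => ?_⟩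
    have h1 : W.coeff (v + expZ) ≠ 0 := by
      have e1 : (γ ^ 2).coeff (v + expZ + 2 • expU) = 0 := by
        by_contra h; have := (hγγ _ h).1; simp [hv0] at this
      have e4 : (algebraMap ℂ _ (c - β ^ 2 * c') + algebraMap ℂ _ (β ^ 2 * α' - α * μ) *
          mono (expU : Expo n)).coeff (v + expZ + 2 • expU) = 0 := by
        by_contra h; have := (hlin _ _ _ h).1; simp [hv0] at this
      have e5 : 2 * algebraMap ℂ _ β * γ * mono expZ = (2 * β) • (mono expZ * γ) := by
        rw [Algebra.smul_def, map_mul, map_ofNat]; ring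
      rw [show v + expZ = v + expZ + 2 • expU - 2 • expU by abel, ← hcoef, hUW, e5,
        AddMonoidAlgebra.coeff_add, Finsupp.add_apply, e4, AddMonoidAlgebra.coeff_sub,
        Finsupp.sub_apply, e1, AddMonoidAlgebra.coeff_neg, Finsupp.neg_apply,
        AddMonoidAlgebra.coeff_smul, Finsupp.smul_apply, coeff_mono_mul,
        show v + expZ + 2 • expU - expZ = v + 2 • expU by abel]
      simpa using ⟨hβ, by simpa using hv⟩
    simpa using hWnn _ h1 i.succ
  -- what remains is a multiple of `u²`, but it is a polynomial of degree one in `u`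
  set V := W + 2 * algebraMap ℂ _ β * γ' * mono expZ + γ' * γ with hV
  have hVA : V ∈ coordRing n α' c' := add_mem (add_mem hWA (mul_mem (mul_mem (mul_mem
    (ofNat_mem _ 2) (Subalgebra.algebraMap_mem _ _)) hγX.mem) mono_expZ_mem))
    (mul_mem hγX.mem hγ.mem)
  have hUV : mono (2 • expU) * V = algebraMap ℂ _ (c - β ^ 2 * c') +
      algebraMap ℂ _ (β ^ 2 * α' - α * μ) * mono expU := by
    rw [mono_nsmul]
    linear_combination hUW - (2 * algebraMap ℂ _ β * mono expZ + γ) * hγu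
  have hVnn := nonneg_of_zDegree_le_one hVA fun v hv => by
    have h1 : (mono (2 • expU) * V).coeff (v + 2 • expU) ≠ 0 := by
      rw [coeff_mono_mul, add_sub_cancel_right]; exact hv
    rw [hUV] at h1
    have := (hlin _ _ _ h1).1
    have h2 : v 0 = 0 := by simpa using this
    omega
  let i₀ : Fin n := ⟨0, hn⟩
  have hsmall : ∀ v : Expo n, v i₀.succ ≤ 1 → (algebraMap ℂ _ (c - β ^ 2 * c') +
      algebraMap ℂ _ (β ^ 2 * α' - α * μ) * mono (expU : Expo n)).coeff v = 0 := by
    intro v hv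
    rw [← hUV, coeff_mono_mul]
    by_contra h
    have := hVnn _ h i₀.succ
    rw [expo_sub_apply, expo_nsmul_apply, expU_succ] at this
    push_cast at this
    omega
  have hne : (expU : Expo n) ≠ 0 := fun h => by
    have := congrFun h i₀.succ
    rw [expU_succ] at this
    exact one_ne_zero this
  have h0 := hsmall 0 (by simp)
  have h1 := hsmall expU (by simp)
  rw [← Algebra.smul_def, Algebra.algebraMap_eq_smul_one, ← mono_zero,
    AddMonoidAlgebra.coeff_add, Finsupp.add_apply, AddMonoidAlgebra.coeff_smul,
    AddMonoidAlgebra.coeff_smul, Finsupp.smul_apply, Finsupp.smul_apply, mono, mono,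
    AddMonoidAlgebra.coeff_single, AddMonoidAlgebra.coeff_single] at h0 h1
  rw [Finsupp.single_eq_same, Finsupp.single_eq_of_ne hne.symm] at h0
  rw [Finsupp.single_eq_same, Finsupp.single_eq_of_ne hne] at h1
  simp only [smul_eq_mul, mul_one, mul_zero, add_zero, zero_add] at h0 h1
  exact ⟨sub_eq_zero.mp h0, (sub_eq_zero.mp h1).symm⟩

/-! ### Functions on the hypersurface `u² y + z² + u q(z²) = c` -/

/-- The polynomial `u² y + z² + u q(z²) - c`, where `u = x₁ ⋯ xₙ`. -/
noncomputable def hyperPoly (n : ℕ) (q : Polynomial ℂ) (c : ℂ) : PolyRing (n + 2) :=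
  xProd n ^ 2 * yVar n + zVar n ^ 2 + xProd n * Polynomial.aeval (zVar n ^ 2) q - C c

lemma polyP_sub_one (a : ℂ) : polyP n a - 1 = hyperPoly n (Polynomial.X - Polynomial.C a) 1 := by
  simp [polyP, hyperPoly, MvPolynomial.algebraMap_eq]

lemma polyQ_sub_C (k : ℕ) (c : ℂ) : polyQ n k - C c = hyperPoly n ((Polynomial.X - 1) ^ k) c := by
  simp [polyQ, hyperPoly]

/-- The value of `u = x₁ ⋯ xₙ` at a point. -/
def uVal (p : AffSpace (n + 2)) : ℂ := ∏ i : Fin n, p (Fin.castAdd 2 i)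

/-- The `y`-coordinate of a point. -/
def yVal (p : AffSpace (n + 2)) : ℂ := p (Fin.natAdd n 0)

/-- The `z`-coordinate of a point. -/
def zVal (p : AffSpace (n + 2)) : ℂ := p (Fin.natAdd n 1)

lemma eval_xProd (p : AffSpace (n + 2)) : eval p (xProd n) = uVal p := by
  simp [xProd, uVal, map_prod]

lemma eval_yVar (p : AffSpace (n + 2)) : eval p (yVar n) = yVal p := by simp [yVar, yVal]

lemma eval_zVar (p : AffSpace (n + 2)) : eval p (zVar n) = zVal p := by simp [zVar, zVal]

lemma eval_polynomial_aeval {N : ℕ} (p : AffSpace N) (f : PolyRing N) (q : Polynomial ℂ) :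
    eval p (Polynomial.aeval f q) = q.eval (eval p f) := by
  rw [← Polynomial.coe_aeval_eq_eval, ← MvPolynomial.coe_aeval_eq_eval]
  exact (Polynomial.aeval_algHom_apply (MvPolynomial.aeval p) f q).symm

lemma eval_hyperPoly (q : Polynomial ℂ) (c : ℂ) (p : AffSpace (n + 2)) :
    eval p (hyperPoly n q c) =
      uVal p ^ 2 * yVal p + zVal p ^ 2 + uVal p * q.eval (zVal p ^ 2) - c := by
  simp [hyperPoly, eval_xProd, eval_yVar, eval_zVar, eval_polynomial_aeval]

lemma mem_zeroSet_hyperPoly {q : Polynomial ℂ} {c : ℂ} {p : AffSpace (n + 2)} :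
    p ∈ zeroSet (hyperPoly n q c) ↔
      uVal p ^ 2 * yVal p + zVal p ^ 2 + uVal p * q.eval (zVal p ^ 2) = c := by
  rw [zeroSet, Set.mem_ofPred_eq, eval_hyperPoly, sub_eq_zero]

@[simp] lemma uVal_coords (x : Fin n → ℂ) (y z : ℂ) : uVal (coords x y z) = ∏ i, x i := by
  simp [uVal]

@[simp] lemma yVal_coords (x : Fin n → ℂ) (y z : ℂ) : yVal (coords x y z) = y := by simp [yVal]

@[simp] lemma zVal_coords (x : Fin n → ℂ) (y z : ℂ) : zVal (coords x y z) = z := by simp [zVal]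

lemma point_ext {R : Type*} {p p' : Fin (n + 2) → R}
    (hx : ∀ i, p (Fin.castAdd 2 i) = p' (Fin.castAdd 2 i))
    (hy : p (Fin.natAdd n 0) = p' (Fin.natAdd n 0))
    (hz : p (Fin.natAdd n 1) = p' (Fin.natAdd n 1)) : p = p' :=
  funext (forall_coords hx hy hz)

/-- The polynomials that do not involve `y`. -/
noncomputable def yFree (n : ℕ) : Subalgebra ℂ (PolyRing (n + 2)) :=
  supported ℂ {i | i ≠ Fin.natAdd n 0}

lemma x_mem_yFree (i : Fin n) : X (Fin.castAdd 2 i) ∈ yFree n := by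
  rw [yFree, X_mem_supported]
  simp [Fin.ext_iff]
  omega

lemma xProd_mem_yFree : xProd n ∈ yFree n := prod_mem fun i _ => x_mem_yFree i

lemma zVar_mem_yFree : zVar n ∈ yFree n := by
  rw [yFree, zVar, X_mem_supported]
  simp [Fin.ext_iff]

lemma aeval_mem_yFree (q : Polynomial ℂ) : Polynomial.aeval (zVar n ^ 2) q ∈ yFree n :=
  Algebra.adjoin_le (Set.singleton_subset_iff.mpr (pow_mem zVar_mem_yFree 2))
    (Polynomial.aeval_mem_adjoin_singleton ℂ _)

lemma eval_eq_of_mem_yFree {g : PolyRing (n + 2)} (hg : g ∈ yFree n) {p p' : AffSpace (n + 2)}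
    (hx : ∀ i : Fin n, p (Fin.castAdd 2 i) = p' (Fin.castAdd 2 i))
    (hz : p (Fin.natAdd n 1) = p' (Fin.natAdd n 1)) : eval p g = eval p' g := by
  rw [yFree, mem_supported] at hg
  refine eval₂Hom_congr' rfl (fun i hi hi' => ?_) rfl
  have h : i ≠ Fin.natAdd n 0 := hg (Finset.mem_coe.mpr hi)
  clear hi hi'
  revert i
  exact forall_coords (fun i _ => hx i) (fun h => absurd rfl h) (fun _ => hz)

lemma exists_yFree_remainder (q : Polynomial ℂ) (c : ℂ) (f : PolyRing (n + 2)) :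
    ∃ (N : ℕ) (h g : PolyRing (n + 2)), g ∈ yFree n ∧
      xProd n ^ (2 * N) * f = hyperPoly n q c * h + g := by
  induction f using MvPolynomial.induction_on with
  | C a => exact ⟨0, 0, C a, (yFree n).algebraMap_mem a, by ring⟩
  | add f₁ f₂ h₁ h₂ =>
    obtain ⟨N₁, a₁, g₁, hg₁, e₁⟩ := h₁
    obtain ⟨N₂, a₂, g₂, hg₂, e₂⟩ := h₂
    refine ⟨N₁ + N₂, xProd n ^ (2 * N₂) * a₁ + xProd n ^ (2 * N₁) * a₂,
      xProd n ^ (2 * N₂) * g₁ + xProd n ^ (2 * N₁) * g₂,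
      add_mem (mul_mem (pow_mem xProd_mem_yFree _) hg₁)
        (mul_mem (pow_mem xProd_mem_yFree _) hg₂), ?_⟩
    rw [mul_add 2, pow_add]
    linear_combination xProd n ^ (2 * N₂) * e₁ + xProd n ^ (2 * N₁) * e₂
  | mul_X f i h =>
    obtain ⟨N, a, g, hg, e⟩ := h
    have hfree : X i ∈ yFree n → ∃ (N : ℕ) (h g : PolyRing (n + 2)), g ∈ yFree n ∧
        xProd n ^ (2 * N) * (f * X i) = hyperPoly n q c * h + g := fun hi =>
      ⟨N, a * X i, g * X i, mul_mem hg hi, by linear_combination X i * e⟩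
    revert i
    refine forall_coords (fun i h => h (x_mem_yFree i)) (fun _ => ?_) (fun h => h zVar_mem_yFree)
    change ∃ (N : ℕ) (h g : PolyRing (n + 2)), g ∈ yFree n ∧
        xProd n ^ (2 * N) * (f * yVar n) = hyperPoly n q c * h + g
    refine ⟨N + 1, a * xProd n ^ 2 * yVar n + g,
      g * (C c - zVar n ^ 2 - xProd n * Polynomial.aeval (zVar n ^ 2) q),
      mul_mem hg (sub_mem (sub_mem ((yFree n).algebraMap_mem c) (pow_mem zVar_mem_yFree 2))
        (mul_mem xProd_mem_yFree (aeval_mem_yFree q))), ?_⟩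
    rw [mul_add 2, pow_add]
    rw [hyperPoly] at e ⊢
    linear_combination xProd n ^ 2 * yVar n * e

lemma isRelPrime_hyperPoly_xProd (q : Polynomial ℂ) (c : ℂ) :
    IsRelPrime (hyperPoly n q c) (xProd n) := by
  refine IsRelPrime.prod_right fun i _ => IsRelPrime.symm ?_
  rw [(X_prime (R := ℂ)).irreducible.isRelPrime_iff_not_dvd]
  rintro ⟨h, hh⟩
  have key : ∀ z : ℂ, z ^ 2 = c := by
    intro z
    have h1 := congrArg (eval (coords (fun _ : Fin n => (0 : ℂ)) 0 z)) hh
    have hu : ∏ _i : Fin n, (0 : ℂ) = 0 := Finset.prod_eq_zero (Finset.mem_univ i) rfl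
    rw [eval_hyperPoly, uVal_coords, hu] at h1
    simp only [map_mul, eval_X, coords_x, zVal_coords] at h1
    linear_combination h1
  have h0 := key 0
  have h1 := key 1
  rw [← h0] at h1
  norm_num at h1

/-- A polynomial that vanishes at the general points of the hypersurface is divisible by its
equation. -/
lemma hyperPoly_dvd_of_vanish {q : Polynomial ℂ} {c : ℂ} {f : PolyRing (n + 2)}
    (hf : ∀ p ∈ zeroSet (hyperPoly n q c), (∀ i : Fin n, p (Fin.castAdd 2 i) ≠ 0) → zVal p ≠ 0 →
      eval p f = 0) : hyperPoly n q c ∣ f := by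
  obtain ⟨N, h, g, hg, e⟩ := exists_yFree_remainder q c f
  have hg0 : xProd n * zVar n * g = 0 := by
    apply MvPolynomial.funext
    intro p
    rw [map_mul, map_mul, eval_xProd, eval_zVar, map_zero]
    by_cases hz : zVal p = 0
    · simp [hz]
    by_cases hu : uVal p = 0
    · simp [hu]
    -- move `p` to the hypersurface along `y`, which does not change the value of `g`
    let y := (c - zVal p ^ 2 - uVal p * q.eval (zVal p ^ 2)) / uVal p ^ 2
    let p' : AffSpace (n + 2) := coords (fun i => p (Fin.castAdd 2 i)) y (zVal p)
    have hu' : uVal p' = uVal p := by rw [uVal_coords]; rfl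
    have hp' : p' ∈ zeroSet (hyperPoly n q c) := by
      rw [mem_zeroSet_hyperPoly, hu', yVal_coords, zVal_coords]
      simp only [y]
      field_simp
      ring
    have hx : ∀ i : Fin n, p (Fin.castAdd 2 i) ≠ 0 := fun i =>
      Finset.prod_ne_zero_iff.mp hu i (Finset.mem_univ i)
    have h1 := hf p' hp' (by simpa [p'] using hx) (by simpa [p'] using hz)
    have h2 := congrArg (eval p') e
    have hp'' : eval p' (hyperPoly n q c) = 0 := hp'
    rw [map_mul, h1, map_add, map_mul, hp'', mul_zero, zero_mul, zero_add] at h2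
    rw [eval_eq_of_mem_yFree hg (p := p) (p' := p') (by simp [p']) (by simp [p', zVal]), ← h2,
      mul_zero]
  have hx0 : xProd n * zVar n ≠ 0 :=
    mul_ne_zero (Finset.prod_ne_zero_iff.mpr fun i _ => X_ne_zero _) (X_ne_zero _)
  rw [(mul_eq_zero.mp hg0).resolve_left hx0, add_zero] at e
  have : DecompositionMonoid (MvPolynomial (Fin (n + 2)) ℂ) :=
    UniqueFactorizationMonoid.instDecompositionMonoid
  exact ((isRelPrime_hyperPoly_xProd q c).pow_right).dvd_of_dvd_mul_left ⟨h, e⟩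

/-- Evaluation of Laurent polynomials at a point of the torus. -/
noncomputable def torusEval (x : Fin n → ℂ) (hx : ∀ i, x i ≠ 0) (z : ℂ) (hz : z ≠ 0) :
    Laurent n →ₐ[ℂ] ℂ :=
  AddMonoidAlgebra.lift ℂ ℂ (Expo n)
    { toFun := fun v => z ^ (v.toAdd 0) * ∏ i : Fin n, x i ^ (v.toAdd i.succ)
      map_one' := by simp
      map_mul' := by
        intro v w
        simp only [toAdd_mul, expo_add_apply, zpow_add₀ hz, zpow_add₀ (hx _),
          Finset.prod_mul_distrib]
        ring }

lemma torusEval_mono (x : Fin n → ℂ) (hx : ∀ i, x i ≠ 0) (z : ℂ) (hz : z ≠ 0) (v : Expo n) :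
    torusEval x hx z hz (mono v) = z ^ (v 0) * ∏ i : Fin n, x i ^ (v i.succ) := by
  simp [torusEval, mono]

lemma torusEval_toLaurent {p : AffSpace (n + 2)}
    (hp : p ∈ zeroSet (hyperPoly n (Polynomial.C α) c))
    (hx : ∀ i : Fin n, p (Fin.castAdd 2 i) ≠ 0) (hz : zVal p ≠ 0) (f : PolyRing (n + 2)) :
    torusEval (fun i => p (Fin.castAdd 2 i)) hx (zVal p) hz (toLaurent α c f) = eval p f := by
  have hu : torusEval (fun i => p (Fin.castAdd 2 i)) hx (zVal p) hz (mono expU) = uVal p := by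
    simp [torusEval_mono, uVal]
  have hZ : torusEval (fun i => p (Fin.castAdd 2 i)) hx (zVal p) hz (mono expZ) = zVal p := by
    simp [torusEval_mono]
  have hu0 : uVal p ≠ 0 := Finset.prod_ne_zero_iff.mpr fun i _ => hx i
  rw [mem_zeroSet_hyperPoly, Polynomial.eval_C] at hp
  have hY : torusEval (fun i => p (Fin.castAdd 2 i)) hx (zVal p) hz (laurentY α c) = yVal p := by
    have h := congrArg (torusEval (fun i => p (Fin.castAdd 2 i)) hx (zVal p) hz)
      (laurentY_spec α c)
    simp only [map_mul, map_pow, map_sub, hu, hZ, AlgHom.commutes, Algebra.algebraMap_self,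
      RingHom.id_apply] at h
    apply mul_left_cancel₀ (pow_ne_zero 2 hu0)
    linear_combination h - hp
  have : (torusEval (fun i => p (Fin.castAdd 2 i)) hx (zVal p) hz).comp (toLaurent α c) =
      aeval p := by
    apply MvPolynomial.algHom_ext
    refine forall_coords (fun i => ?_) ?_ ?_
    · rw [AlgHom.comp_apply, toLaurent_x, torusEval_mono, aeval_X]
      simp
    · rw [AlgHom.comp_apply]
      change torusEval _ _ _ _ (toLaurent α c (yVar n)) = _
      rw [toLaurent_y, hY, aeval_X]; rfl
    · rw [AlgHom.comp_apply]
      change torusEval _ _ _ _ (toLaurent α c (zVar n)) = _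
      rw [toLaurent_z, hZ, aeval_X]; rfl
  exact DFunLike.congr_fun this f

/-- The Laurent polynomial of `f` vanishes exactly if `f` vanishes on the hypersurface. -/
lemma toLaurent_eq_zero_iff {f : PolyRing (n + 2)} : toLaurent α c f = 0 ↔
    ∀ p ∈ zeroSet (hyperPoly n (Polynomial.C α) c), eval p f = 0 := by
  constructor
  · intro h p hp
    obtain ⟨g, rfl⟩ := hyperPoly_dvd_of_vanish (f := f) fun p hp hx hz => by
      rw [← torusEval_toLaurent hp hx hz, h, map_zero]
    rw [map_mul, show eval p (hyperPoly n (Polynomial.C α) c) = 0 from hp, zero_mul]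
  · intro h
    obtain ⟨g, rfl⟩ := hyperPoly_dvd_of_vanish (f := f) fun p hp _ _ => h p hp
    have : toLaurent α c (hyperPoly n (Polynomial.C α) c) = 0 := by
      simp only [hyperPoly, map_sub, map_add, map_mul, map_pow, toLaurent_xProd, toLaurent_y,
        toLaurent_z, Polynomial.aeval_C, AlgHom.commutes]
      rw [← MvPolynomial.algebraMap_eq, AlgHom.commutes]
      linear_combination laurentY_spec (n := n) α c
    rw [map_mul, this, zero_mul]

lemma eval_aeval {N M : ℕ} (F : Fin M → PolyRing N) (f : PolyRing M) (p : AffSpace N) :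
    eval p (aeval F f) = eval (polyMap F p) f := by
  induction f using MvPolynomial.induction_on with
  | C a => simp
  | add f g hf hg => rw [map_add, map_add, map_add, hf, hg]
  | mul_X f i hf => rw [map_mul, map_mul, map_mul, hf, aeval_X, eval_X]; rfl

/-- The homomorphism of coordinate rings induced by a regular map of hypersurfaces. -/
noncomputable def coordRingHom (F : Fin (n + 2) → PolyRing (n + 2))
    (hF : Set.MapsTo (polyMap F) (zeroSet (hyperPoly n (Polynomial.C α) c))
      (zeroSet (hyperPoly n (Polynomial.C α') c'))) :
    coordRing n α' c' →ₐ[ℂ] coordRing n α c :=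
  AlgHom.liftOfSurjective (toLaurent α' c').rangeRestrict
    (toLaurent α' c').rangeRestrict_surjective
    ((toLaurent α c).rangeRestrict.comp (aeval F)) (by
      intro f hf
      have h1 : toLaurent α' c' f = 0 := congrArg Subtype.val hf
      refine Subtype.ext ?_
      change toLaurent α c (aeval F f) = 0
      rw [toLaurent_eq_zero_iff] at h1 ⊢
      intro p hp
      rw [eval_aeval]
      exact h1 _ (hF hp))

lemma coordRingHom_apply (F : Fin (n + 2) → PolyRing (n + 2))
    (hF : Set.MapsTo (polyMap F) (zeroSet (hyperPoly n (Polynomial.C α) c))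
      (zeroSet (hyperPoly n (Polynomial.C α') c'))) (f : PolyRing (n + 2)) :
    coordRingHom F hF ((toLaurent α' c').rangeRestrict f) =
      (toLaurent α c).rangeRestrict (aeval F f) :=
  AlgHom.liftOfSurjective_apply ..

lemma coordRingHom_comp {F G : Fin (n + 2) → PolyRing (n + 2)}
    (hF : Set.MapsTo (polyMap F) (zeroSet (hyperPoly n (Polynomial.C α) c))
      (zeroSet (hyperPoly n (Polynomial.C α') c')))
    (hG : Set.MapsTo (polyMap G) (zeroSet (hyperPoly n (Polynomial.C α') c'))
      (zeroSet (hyperPoly n (Polynomial.C α) c)))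
    (hFG : Set.LeftInvOn (polyMap G) (polyMap F) (zeroSet (hyperPoly n (Polynomial.C α) c))) :
    (coordRingHom F hF).comp (coordRingHom G hG) = AlgHom.id ℂ _ := by
  apply AlgHom.ext
  rintro ⟨_, f, rfl⟩
  change coordRingHom F hF (coordRingHom G hG ((toLaurent α c).rangeRestrict f)) =
    (toLaurent α c).rangeRestrict f
  rw [coordRingHom_apply, coordRingHom_apply]
  refine Subtype.ext ?_
  change toLaurent α c (aeval F (aeval G f)) = toLaurent α c f
  rw [← sub_eq_zero, ← map_sub, toLaurent_eq_zero_iff]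
  intro p hp
  rw [map_sub, eval_aeval, eval_aeval, hFG hp, sub_self]

/-- Isomorphisms between the hypersurfaces `u² y + z² + α u = c`. -/
lemma exists_scalars_of_isomorphism (hn : 1 ≤ n) {F G : Fin (n + 2) → PolyRing (n + 2)}
    (hF : Set.MapsTo (polyMap F) (zeroSet (hyperPoly n (Polynomial.C α) c))
      (zeroSet (hyperPoly n (Polynomial.C α') c')))
    (hG : Set.MapsTo (polyMap G) (zeroSet (hyperPoly n (Polynomial.C α') c'))
      (zeroSet (hyperPoly n (Polynomial.C α) c)))
    (hFG : Set.LeftInvOn (polyMap G) (polyMap F) (zeroSet (hyperPoly n (Polynomial.C α) c)))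
    (hGF : Set.RightInvOn (polyMap G) (polyMap F) (zeroSet (hyperPoly n (Polynomial.C α') c'))) :
    ∃ μ β : ℂ, μ ≠ 0 ∧ β ≠ 0 ∧
      (∀ p ∈ zeroSet (hyperPoly n (Polynomial.C α) c), uVal (polyMap F p) = μ * uVal p) ∧
      c' = β ^ 2 * c ∧ α' * μ = β ^ 2 * α := by
  let Ψ : coordRing n α' c' ≃ₐ[ℂ] coordRing n α c :=
    AlgEquiv.ofAlgHom (coordRingHom F hF) (coordRingHom G hG) (coordRingHom_comp hF hG hFG)
      (coordRingHom_comp hG hF hGF)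
  obtain ⟨μ, β, hμ, hβ, hu, hc, hα⟩ := exists_scalars_of_coordRing_equiv hn Ψ
  refine ⟨μ, β, hμ, hβ, fun p hp => ?_, hc, hα⟩
  have h1 : (⟨_, mono_expU_mem⟩ : coordRing n α' c') =
      (toLaurent α' c').rangeRestrict (xProd n) := Subtype.ext (toLaurent_xProd α' c').symm
  have h2 : Ψ ⟨_, mono_expU_mem⟩ = (toLaurent α c).rangeRestrict (aeval F (xProd n)) := by
    rw [h1]; exact coordRingHom_apply F hF (xProd n)
  rw [h2] at hu
  have h3 : toLaurent α c (aeval F (xProd n) - algebraMap ℂ _ μ * xProd n) = 0 := by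
    rw [map_sub, map_mul, AlgHom.commutes, toLaurent_xProd, sub_eq_zero]
    exact hu
  have h4 := toLaurent_eq_zero_iff.mp h3 p hp
  rw [map_sub, eval_aeval, eval_xProd, map_mul, eval_xProd, MvPolynomial.algebraMap_eq, eval_C,
    sub_eq_zero] at h4
  exact h4

/-! ### Isomorphisms and equivalences of varieties -/

lemma polyMap_comp {N M K : ℕ} (F : Fin M → PolyRing N) (G : Fin K → PolyRing M)
    (p : AffSpace N) : polyMap (fun j => aeval F (G j)) p = polyMap G (polyMap F p) := by
  funext j
  exact eval_aeval F (G j) p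

lemma polyMap_comp_eq {N M K : ℕ} (F : Fin M → PolyRing N) (G : Fin K → PolyRing M) :
    polyMap (fun j => aeval F (G j)) = polyMap G ∘ polyMap F :=
  funext (polyMap_comp F G)

lemma IsomorphicVarieties.symm {N M : ℕ} {V : Set (AffSpace N)} {W : Set (AffSpace M)}
    (h : IsomorphicVarieties V W) : IsomorphicVarieties W V := by
  obtain ⟨F, G, hF, hG, h1, h2⟩ := h
  exact ⟨G, F, hG, hF, h2, h1⟩

lemma IsomorphicVarieties.trans {N M K : ℕ} {V : Set (AffSpace N)} {W : Set (AffSpace M)}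
    {Z : Set (AffSpace K)} (h : IsomorphicVarieties V W) (h' : IsomorphicVarieties W Z) :
    IsomorphicVarieties V Z := by
  obtain ⟨F, G, hF, hG, h1, h2⟩ := h
  obtain ⟨F', G', hF', hG', h1', h2'⟩ := h'
  refine ⟨fun j => aeval F (F' j), fun j => aeval G' (G j), ?_, ?_, ?_, ?_⟩
  · rw [polyMap_comp_eq]; exact hF'.comp hF
  · rw [polyMap_comp_eq]; exact hG.comp hG'
  · rw [polyMap_comp_eq, polyMap_comp_eq]; exact h1.comp h1' hF
  · rw [polyMap_comp_eq, polyMap_comp_eq]; exact Set.LeftInvOn.comp h2' h2 hG'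

lemma EquivalentVarieties.isomorphic {N : ℕ} {V W : Set (AffSpace N)}
    (h : EquivalentVarieties V W) : IsomorphicVarieties V W := by
  obtain ⟨Φ, rfl⟩ := h
  refine ⟨Φ.comp, Φ.invComp, Set.mapsTo_image _ _, ?_, fun p _ => Φ.left_inv p,
    fun p _ => Φ.right_inv p⟩
  rintro _ ⟨p, hp, rfl⟩
  rw [PolyAut.toMap, Φ.left_inv p]
  exact hp

lemma EquivalentPolynomials.equivalentVarieties {N : ℕ} {P Q : PolyRing N}
    (h : EquivalentPolynomials P Q) : EquivalentVarieties (zeroSet Q) (zeroSet P) := by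
  obtain ⟨Φ, rfl⟩ := h
  have hmem : ∀ p, p ∈ zeroSet (Φ.pullback P) ↔ polyMap Φ.comp p ∈ zeroSet P := by
    intro p
    rw [zeroSet, Set.mem_ofPred_eq, PolyAut.pullback, eval_aeval]
    rfl
  refine ⟨Φ, Set.Subset.antisymm ?_ fun p hp => ⟨polyMap Φ.invComp p, ?_, Φ.right_inv p⟩⟩
  · rintro _ ⟨p, hp, rfl⟩
    exact (hmem p).mp hp
  · rw [hmem, Φ.right_inv p]
    exact hp

lemma cylinder_zeroSet {N : ℕ} (P : PolyRing N) (m : ℕ) :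
    cylinder (zeroSet P) m = zeroSet (rename (Fin.castAdd m) P : PolyRing (N + m)) := by
  ext p
  rw [cylinder, zeroSet, zeroSet, Set.mem_ofPred_eq, Set.mem_ofPred_eq, Set.mem_ofPred_eq,
    eval_rename]
  rfl

/-! ### Isomorphisms between the hypersurfaces -/

lemma polyMap_coords {N : ℕ} (x : Fin n → PolyRing N) (y z : PolyRing N) (p : AffSpace N) :
    polyMap (coords x y z) p = coords (fun i => eval p (x i)) (eval p y) (eval p z) :=
  point_ext (by simp [polyMap]) (by simp [polyMap]) (by simp [polyMap])

/-- The map that replaces the coordinate `y` by a polynomial. -/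
noncomputable def replaceY (g : PolyRing (n + 2)) : Fin (n + 2) → PolyRing (n + 2) :=
  coords (fun i => X (Fin.castAdd 2 i)) g (zVar n)

lemma uVal_replaceY (g : PolyRing (n + 2)) (p : AffSpace (n + 2)) :
    uVal (polyMap (replaceY g) p) = uVal p := by
  simp [replaceY, polyMap_coords, uVal]

lemma yVal_replaceY (g : PolyRing (n + 2)) (p : AffSpace (n + 2)) :
    yVal (polyMap (replaceY g) p) = eval p g := by
  simp [replaceY, polyMap_coords]

lemma zVal_replaceY (g : PolyRing (n + 2)) (p : AffSpace (n + 2)) :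
    zVal (polyMap (replaceY g) p) = zVal p := by
  simp [replaceY, polyMap_coords, eval_zVar]

lemma replaceY_replaceY_eq {g h : PolyRing (n + 2)} {p : AffSpace (n + 2)}
    (hy : eval (polyMap (replaceY g) p) h = yVal p) :
    polyMap (replaceY h) (polyMap (replaceY g) p) = p := by
  refine point_ext ?_ ?_ ?_
  · simp [replaceY, polyMap_coords]
  · exact (yVal_replaceY _ _).trans hy
  · exact (zVal_replaceY _ _).trans (zVal_replaceY _ _)

/-- On the hypersurface `u² y + z² + u q(z²) = c` the polynomial `q(z²)` is congruent to the
constant `q(c)` modulo `u`, so that a change of the coordinate `y` replaces `q` by `q(c)`. -/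
lemma exists_normalization (q : Polynomial ℂ) (c : ℂ) :
    ∃ g h : PolyRing (n + 2),
      Set.MapsTo (polyMap (replaceY g)) (zeroSet (hyperPoly n q c))
        (zeroSet (hyperPoly n (Polynomial.C (q.eval c)) c)) ∧
      Set.MapsTo (polyMap (replaceY h)) (zeroSet (hyperPoly n (Polynomial.C (q.eval c)) c))
        (zeroSet (hyperPoly n q c)) ∧
      Set.LeftInvOn (polyMap (replaceY h)) (polyMap (replaceY g)) (zeroSet (hyperPoly n q c)) ∧
      Set.RightInvOn (polyMap (replaceY h)) (polyMap (replaceY g))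
        (zeroSet (hyperPoly n (Polynomial.C (q.eval c)) c)) := by
  obtain ⟨q₁, hq₁⟩ := Polynomial.X_sub_C_dvd_sub_C_eval (a := c) (p := q)
  have hq : ∀ s : ℂ, q.eval s = q.eval c + (s - c) * q₁.eval s := by
    intro s
    have := congrArg (Polynomial.eval s) hq₁
    simp only [Polynomial.eval_sub, Polynomial.eval_C, Polynomial.eval_mul,
      Polynomial.eval_X] at this
    linear_combination this
  let g : PolyRing (n + 2) := yVar n - (Polynomial.aeval (zVar n ^ 2) q + xProd n * yVar n) *
    Polynomial.aeval (zVar n ^ 2) q₁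
  let h : PolyRing (n + 2) := yVar n + (C (q.eval c) + xProd n * yVar n) *
    Polynomial.aeval (zVar n ^ 2) q₁
  have hg : ∀ p, eval p g = yVal p -
      (q.eval (zVal p ^ 2) + uVal p * yVal p) * q₁.eval (zVal p ^ 2) := by
    intro p
    simp [g, eval_xProd, eval_yVar, eval_zVar, eval_polynomial_aeval]
  have hh : ∀ p, eval p h = yVal p +
      (q.eval c + uVal p * yVal p) * q₁.eval (zVal p ^ 2) := by
    intro p
    simp [h, eval_xProd, eval_yVar, eval_zVar, eval_polynomial_aeval]
  refine ⟨g, h, fun p hp => ?_, fun p hp => ?_, fun p hp => ?_, fun p hp => ?_⟩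
  · rw [mem_zeroSet_hyperPoly] at hp ⊢
    rw [uVal_replaceY, yVal_replaceY, zVal_replaceY, hg, Polynomial.eval_C]
    linear_combination (1 - uVal p * q₁.eval (zVal p ^ 2)) * hp - uVal p * hq (zVal p ^ 2)
  · rw [mem_zeroSet_hyperPoly] at hp ⊢
    rw [Polynomial.eval_C] at hp
    rw [uVal_replaceY, yVal_replaceY, zVal_replaceY, hh]
    linear_combination (1 + uVal p * q₁.eval (zVal p ^ 2)) * hp + uVal p * hq (zVal p ^ 2)
  · rw [mem_zeroSet_hyperPoly] at hp
    refine replaceY_replaceY_eq ?_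
    rw [hh, uVal_replaceY, yVal_replaceY, zVal_replaceY, hg]
    linear_combination (-q₁.eval (zVal p ^ 2)) * hq (zVal p ^ 2) +
      q₁.eval (zVal p ^ 2) ^ 2 * (- hp)
  · rw [mem_zeroSet_hyperPoly, Polynomial.eval_C] at hp
    refine replaceY_replaceY_eq ?_
    rw [hg, uVal_replaceY, yVal_replaceY, zVal_replaceY, hh]
    linear_combination (-q₁.eval (zVal p ^ 2)) * hq (zVal p ^ 2) +
      q₁.eval (zVal p ^ 2) ^ 2 * (- hp)

lemma isomorphic_normalization (q : Polynomial ℂ) (c : ℂ) :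
    IsomorphicVarieties (zeroSet (hyperPoly n q c))
      (zeroSet (hyperPoly n (Polynomial.C (q.eval c)) c)) := by
  obtain ⟨g, h, H⟩ := exists_normalization (n := n) q c
  exact ⟨_, _, H⟩

/-- The factors by which the coordinates `xᵢ` are rescaled so that `u` is multiplied by `t`. -/
def scale (i₀ : Fin n) (t : ℂ) (i : Fin n) : ℂ := if i = i₀ then t else 1

lemma prod_scale_mul (i₀ : Fin n) (t : ℂ) (x : Fin n → ℂ) :
    ∏ i, scale i₀ t i * x i = t * ∏ i, x i := by
  rw [Finset.prod_mul_distrib]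
  simp [scale]

lemma scale_inv_mul (i₀ : Fin n) {t : ℂ} (ht : t ≠ 0) (i : Fin n) (x : ℂ) :
    scale i₀ t⁻¹ i * (scale i₀ t i * x) = x := by
  unfold scale
  split_ifs
  · field_simp
  · simp

lemma isomorphic_scale (hn : 1 ≤ n) {t : ℂ} (ht : t ≠ 0) (q : Polynomial ℂ) (c : ℂ) :
    IsomorphicVarieties (zeroSet (hyperPoly n (Polynomial.C t * q) c))
      (zeroSet (hyperPoly n q c)) := by
  let i₀ : Fin n := ⟨0, hn⟩
  let F : ℂ → Fin (n + 2) → PolyRing (n + 2) := fun t =>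
    coords (fun i => C (scale i₀ t i) * X (Fin.castAdd 2 i)) (C (t⁻¹ ^ 2) * yVar n) (zVar n)
  have hF : ∀ t p, polyMap (F t) p =
      coords (fun i => scale i₀ t i * p (Fin.castAdd 2 i)) (t⁻¹ ^ 2 * yVal p) (zVal p) := by
    intro t p
    rw [polyMap_coords]
    simp [eval_yVar, eval_zVar]
  have hinv : ∀ t : ℂ, t ≠ 0 → ∀ p, polyMap (F t⁻¹) (polyMap (F t) p) = p := by
    intro t ht p
    rw [hF, hF]
    refine point_ext (fun i => ?_) ?_ ?_
    · simp [scale_inv_mul i₀ ht]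
    · simp only [coords_y, yVal_coords]
      rw [inv_inv, ← mul_assoc, ← mul_pow, mul_inv_cancel₀ ht, one_pow, one_mul]; rfl
    · simp [zVal]
  refine ⟨F t, F t⁻¹, fun p hp => ?_, fun p hp => ?_, fun p _ => hinv t ht p, fun p _ => ?_⟩
  · rw [mem_zeroSet_hyperPoly] at hp ⊢
    rw [hF, uVal_coords, prod_scale_mul, yVal_coords, zVal_coords]
    change (t * uVal p) ^ 2 * _ + _ + t * uVal p * _ = c
    rw [← hp]
    simp only [Polynomial.eval_mul, Polynomial.eval_C]
    field_simp
  · rw [mem_zeroSet_hyperPoly] at hp ⊢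
    rw [hF, uVal_coords, prod_scale_mul, yVal_coords, zVal_coords]
    change (t⁻¹ * uVal p) ^ 2 * _ + _ + t⁻¹ * uVal p * _ = c
    rw [← hp]
    simp only [Polynomial.eval_mul, Polynomial.eval_C]
    field_simp
  · have := hinv t⁻¹ (inv_ne_zero ht) p
    rwa [inv_inv] at this

lemma isomorphic_of_eval_eq_zero_iff (hn : 1 ≤ n) {q q' : Polynomial ℂ} {c : ℂ}
    (h : q.eval c = 0 ↔ q'.eval c = 0) :
    IsomorphicVarieties (zeroSet (hyperPoly n q c)) (zeroSet (hyperPoly n q' c)) := by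
  refine (isomorphic_normalization q c).trans
    (IsomorphicVarieties.trans ?_ (isomorphic_normalization q' c).symm)
  by_cases h0 : q'.eval c = 0
  · rw [h0, h.mpr h0]
    exact (isomorphic_normalization _ c).trans (isomorphic_normalization _ c).symm
  · have h1 : q.eval c ≠ 0 := fun h2 => h0 (h.mp h2)
    have : Polynomial.C (q.eval c) =
        Polynomial.C (q.eval c / q'.eval c) * Polynomial.C (q'.eval c) := by
      rw [← Polynomial.C_mul, div_mul_cancel₀ _ h0]
    rw [this]
    exact isomorphic_scale hn (div_ne_zero h1 h0) _ c

/-! ### Stable equivalence -/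

/-- Modulo `u²`, the commutator `(z, w) ↦ (z₂, w₂)` of the shears `z ↦ z + u w` and `w ↦ w + f(z)`
shifts `z` by `u f(z)`. With `2 z f(z) = q'(z²) - t q(z²)` it carries `z² + t u q(z²)` to
`z² + u q'(z²)`. -/
lemma exists_shear_remainder {q q' d f : Polynomial ℂ} {t : ℂ}
    (hd : q' - Polynomial.C t * q = Polynomial.X * d)
    (hf : f = Polynomial.C (1 / 2) * (Polynomial.X * d.comp (Polynomial.X ^ 2))) :
    ∃ R : MvPolynomial (Fin 3) ℂ, ∀ u z w : ℂ,
      (z + u * f.eval (z + u * (w + f.eval z))) ^ 2 +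
        t * u * q.eval ((z + u * f.eval (z + u * (w + f.eval z))) ^ 2) =
      z ^ 2 + u * q'.eval (z ^ 2) + u ^ 2 * eval ![u, z, w] R := by
  let U : MvPolynomial (Fin 3) ℂ := X 0
  let Z : MvPolynomial (Fin 3) ℂ := X 1
  let W : MvPolynomial (Fin 3) ℂ := X 2
  let Z₁ := Z + U * (W + Polynomial.aeval Z f)
  let Z₂ := Z + U * Polynomial.aeval Z₁ f
  obtain ⟨e, he⟩ := (dvd_trans (Dvd.intro _ (add_sub_cancel_left Z (U * _)).symm)
    (Polynomial.sub_dvd_eval_sub Z₁ Z (f.map (algebraMap ℂ _))) : U ∣ _)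
  have h2 : U ∣ Z₂ ^ 2 - Z ^ 2 :=
    ⟨2 * Z * Polynomial.aeval Z₁ f + U * Polynomial.aeval Z₁ f ^ 2, by simp only [Z₂]; ring⟩
  obtain ⟨e', he'⟩ := h2.trans
    (Polynomial.sub_dvd_eval_sub (Z₂ ^ 2) (Z ^ 2) (q.map (algebraMap ℂ _)))
  rw [Polynomial.eval_map_algebraMap, Polynomial.eval_map_algebraMap] at he he'
  refine ⟨2 * Z * e + Polynomial.aeval Z₁ f ^ 2 + C t * e', fun u z w => ?_⟩
  have hU : eval ![u, z, w] U = u := by simp [U]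
  have hZ : eval ![u, z, w] Z = z := by simp [Z]
  have hW : eval ![u, z, w] W = w := by simp [W]
  have hZ₁ : eval ![u, z, w] Z₁ = z + u * (w + f.eval z) := by
    simp [Z₁, hU, hZ, hW, eval_polynomial_aeval]
  have hZ₂ : eval ![u, z, w] Z₂ = z + u * f.eval (z + u * (w + f.eval z)) := by
    simp [Z₂, hU, hZ, hZ₁, eval_polynomial_aeval]
  have he₁ := congrArg (eval ![u, z, w]) he
  have he₂ := congrArg (eval ![u, z, w]) he'
  simp only [map_sub, map_mul, map_pow, eval_polynomial_aeval, hU, hZ, hZ₁, hZ₂] at he₁ he₂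
  have hfz : 2 * z * f.eval z = q'.eval (z ^ 2) - t * q.eval (z ^ 2) := by
    have := congrArg (Polynomial.eval (z ^ 2)) hd
    simp only [Polynomial.eval_sub, Polynomial.eval_mul, Polynomial.eval_C,
      Polynomial.eval_X] at this
    rw [this, hf]
    simp only [Polynomial.eval_mul, Polynomial.eval_C, Polynomial.eval_X, Polynomial.eval_comp,
      Polynomial.eval_pow]
    ring
  simp only [map_add, map_mul, map_pow, map_ofNat, eval_C, eval_polynomial_aeval, hZ, hZ₁]
  linear_combination (2 * z * u) * he₁ + t * u * he₂ + u * hfz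

/-- The point of `ℂ^(n+3)` with coordinates `x₁, …, xₙ, y, z, w`. -/
def coordsW {R : Type*} (x : Fin n → R) (y z w : R) : Fin (n + 2 + 1) → R :=
  Fin.append (coords x y z) ![w]

/-- The projection `(x, y, z, w) ↦ (x, y, z)`. -/
def base {R : Type*} (p : Fin (n + 2 + 1) → R) : Fin (n + 2) → R := fun i => p (Fin.castAdd 1 i)

/-- The `w`-coordinate of a point. -/
def wVal {R : Type*} (p : Fin (n + 2 + 1) → R) : R := p (Fin.natAdd (n + 2) 0)

@[simp] lemma base_coordsW {R : Type*} (x : Fin n → R) (y z w : R) :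
    base (coordsW x y z w) = coords x y z := by
  funext i; simp [base, coordsW]

@[simp] lemma wVal_coordsW {R : Type*} (x : Fin n → R) (y z w : R) :
    wVal (coordsW x y z w) = w := by
  simp [wVal, coordsW]

lemma pointW_ext {R : Type*} {p p' : Fin (n + 2 + 1) → R} (hb : base p = base p')
    (hw : wVal p = wVal p') : p = p' := by
  funext i
  refine Fin.addCases (fun i => congrFun hb i) (fun i => ?_) i
  rw [Subsingleton.elim i 0]
  exact hw

lemma polyMap_coordsW {N : ℕ} (x : Fin n → PolyRing N) (y z w : PolyRing N) (p : AffSpace N) :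
    polyMap (coordsW x y z w) p =
      coordsW (fun i => eval p (x i)) (eval p y) (eval p z) (eval p w) := by
  refine pointW_ext ?_ ?_
  · rw [base_coordsW, ← polyMap_coords]
    funext i
    simp [base, polyMap, coordsW]
  · simp [wVal, polyMap, coordsW]

lemma eval_rename_castAdd (f : PolyRing (n + 2)) (p : AffSpace (n + 2 + 1)) :
    eval p (rename (Fin.castAdd 1) f) = eval (base p) f := by
  rw [eval_rename]; rfl

/-- One more variable `w` makes all polynomials `u² y + z² + u q(z²) - c` with `q(0) ≠ 0`
equivalent. -/
theorem equivalent_rename_hyperPoly (hn : 1 ≤ n) {q q' : Polynomial ℂ} (hq : q.eval 0 ≠ 0)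
    (hq' : q'.eval 0 ≠ 0) (c : ℂ) : EquivalentPolynomials
      (rename (Fin.castAdd 1) (hyperPoly n q c) : PolyRing (n + 2 + 1))
      (rename (Fin.castAdd 1) (hyperPoly n q' c) : PolyRing (n + 2 + 1)) := by
  let i₀ : Fin n := ⟨0, hn⟩
  set t := q'.eval 0 / q.eval 0 with ht
  have ht0 : t ≠ 0 := div_ne_zero hq' hq
  obtain ⟨d, hd⟩ : Polynomial.X ∣ q' - Polynomial.C t * q := by
    rw [Polynomial.X_dvd_iff, Polynomial.coeff_zero_eq_eval_zero]
    simp only [Polynomial.eval_sub, Polynomial.eval_mul, Polynomial.eval_C]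
    rw [ht, div_mul_cancel₀ _ hq, sub_self]
  set f := Polynomial.C (1 / 2) * (Polynomial.X * d.comp (Polynomial.X ^ 2)) with hf
  obtain ⟨R, hR⟩ := exists_shear_remainder hd hf
  -- the coordinate functions
  let x : Fin n → PolyRing (n + 2 + 1) := fun i => X (Fin.castAdd 1 (Fin.castAdd 2 i))
  let u : PolyRing (n + 2 + 1) := rename (Fin.castAdd 1) (xProd n)
  let y : PolyRing (n + 2 + 1) := rename (Fin.castAdd 1) (yVar n)
  let z : PolyRing (n + 2 + 1) := rename (Fin.castAdd 1) (zVar n)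
  let w : PolyRing (n + 2 + 1) := X (Fin.natAdd (n + 2) 0)
  have hx : ∀ p i, eval p (x i) = base p (Fin.castAdd 2 i) := fun p i => by simp [x, base]
  have hu : ∀ p, eval p u = uVal (base p) := fun p => by
    simp only [u]; rw [eval_rename_castAdd, eval_xProd]
  have hy : ∀ p, eval p y = yVal (base p) := fun p => by
    simp only [y]; rw [eval_rename_castAdd, eval_yVar]
  have hz : ∀ p, eval p z = zVal (base p) := fun p => by
    simp only [z]; rw [eval_rename_castAdd, eval_zVar]
  have hw : ∀ p, eval p w = wVal p := fun p => by simp [w, wVal]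
  have hsub : ∀ (p : AffSpace (n + 2 + 1)) (a b e : PolyRing (n + 2 + 1)),
      eval p (aeval ![a, b, e] R) = eval ![eval p a, eval p b, eval p e] R := by
    intro p a b e
    rw [eval_aeval]
    congr 2
    funext i
    fin_cases i <;> rfl
  -- the automorphism
  let z₂ := z + u * Polynomial.aeval (z + u * (w + Polynomial.aeval z f)) f
  let w₂ := w + Polynomial.aeval z f -
    Polynomial.aeval (z + u * (w + Polynomial.aeval z f)) f
  let Φ := coordsW (fun i => C (scale i₀ t i) * x i) (C (t⁻¹ ^ 2) * (y - aeval ![u, z, w] R)) z₂ w₂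
  -- its inverse
  let u' := C t⁻¹ * u
  let w₁ := w + Polynomial.aeval (z + u' * w) f
  let z₀ := z + u' * w - u' * w₁
  let w₀ := w₁ - Polynomial.aeval z₀ f
  let Ψ := coordsW (fun i => C (scale i₀ t⁻¹ i) * x i)
    (C (t ^ 2) * y + aeval ![u', z₀, w₀] R) z₀ w₀
  have hΦ : ∀ p, polyMap Φ p = coordsW (fun i => scale i₀ t i * base p (Fin.castAdd 2 i))
      (t⁻¹ ^ 2 * (yVal (base p) - eval ![uVal (base p), zVal (base p), wVal p] R))
      (zVal (base p) + uVal (base p) *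
        f.eval (zVal (base p) + uVal (base p) * (wVal p + f.eval (zVal (base p)))))
      (wVal p + f.eval (zVal (base p)) -
        f.eval (zVal (base p) + uVal (base p) * (wVal p + f.eval (zVal (base p))))) := by
    intro p
    simp only [Φ]
    rw [polyMap_coordsW]
    simp only [z₂, w₂, map_mul, map_sub, map_add, eval_C, eval_polynomial_aeval, hx, hu, hy, hz,
      hw, hsub]
  have hΨ : ∀ p, ∀ U W₁ Z₀ W₀ : ℂ, U = t⁻¹ * uVal (base p) →
      W₁ = wVal p + f.eval (zVal (base p) + U * wVal p) →
      Z₀ = zVal (base p) + U * wVal p - U * W₁ → W₀ = W₁ - f.eval Z₀ →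
      polyMap Ψ p = coordsW (fun i => scale i₀ t⁻¹ i * base p (Fin.castAdd 2 i))
        (t ^ 2 * yVal (base p) + eval ![U, Z₀, W₀] R) Z₀ W₀ := by
    rintro p _ _ _ _ rfl rfl rfl rfl
    simp only [Ψ]
    rw [polyMap_coordsW]
    simp only [z₀, w₀, w₁, u', map_mul, map_sub, map_add, eval_C, eval_polynomial_aeval, hx, hu,
      hy, hz, hw, hsub]
  have huΦ : ∀ (s : ℂ) (p : AffSpace (n + 2 + 1)),
      ∏ i, scale i₀ s i * base p (Fin.castAdd 2 i) = s * uVal (base p) :=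
    fun s p => prod_scale_mul _ _ _
  refine ⟨⟨Φ, Ψ, fun p => ?_, fun p => ?_⟩, ?_⟩
  · rw [hΨ (polyMap Φ p) (uVal (base p)) (wVal p + f.eval (zVal (base p))) (zVal (base p)) (wVal p)]
    · rw [hΦ]
      refine pointW_ext ?_ ?_
      · rw [base_coordsW, base_coordsW]
        refine point_ext (fun i => ?_) ?_ ?_
        · rw [coords_x, coords_x, scale_inv_mul i₀ ht0]
        · rw [coords_y, yVal_coords]
          change _ = yVal (base p)
          field_simp
          ring
        · rw [coords_z]; rfl
      · rw [wVal_coordsW]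
    · rw [hΦ, base_coordsW, uVal_coords, huΦ, inv_mul_cancel_left₀ ht0]
    · rw [hΦ, base_coordsW, zVal_coords, wVal_coordsW]
      ring_nf
    · rw [hΦ, base_coordsW, zVal_coords, wVal_coordsW]
      ring
    · ring
  · set U := t⁻¹ * uVal (base p) with hU
    set W₁ := wVal p + f.eval (zVal (base p) + U * wVal p) with hW₁
    set Z₀ := zVal (base p) + U * wVal p - U * W₁ with hZ₀
    have hp := hΨ p U W₁ Z₀ _ hU hW₁ hZ₀ rfl
    rw [hΦ, hp, base_coordsW, uVal_coords, huΦ, ← hU, yVal_coords, zVal_coords, wVal_coordsW]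
    have h1 : Z₀ + U * (W₁ - f.eval Z₀ + f.eval Z₀) = zVal (base p) + U * wVal p := by
      rw [hZ₀]; ring
    rw [h1]
    refine pointW_ext ?_ ?_
    · rw [base_coordsW]
      refine point_ext (fun i => ?_) ?_ ?_
      · rw [coords_x, coords_x]
        have := scale_inv_mul i₀ (inv_ne_zero ht0) i (base p (Fin.castAdd 2 i))
        rwa [inv_inv] at this
      · rw [coords_y]
        change _ = yVal (base p)
        field_simp
        ring
      · rw [coords_z]
        change _ = zVal (base p)
        rw [hZ₀, hW₁]
        ring
    · rw [wVal_coordsW, hW₁]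
      ring
  · apply MvPolynomial.funext
    intro p
    rw [PolyAut.pullback, eval_aeval, eval_rename_castAdd, eval_rename_castAdd, eval_hyperPoly,
      eval_hyperPoly]
    change uVal (base (polyMap Φ p)) ^ 2 * yVal (base (polyMap Φ p)) +
      zVal (base (polyMap Φ p)) ^ 2 + uVal (base (polyMap Φ p)) *
      q.eval (zVal (base (polyMap Φ p)) ^ 2) - c = _
    rw [hΦ, base_coordsW, uVal_coords, huΦ, yVal_coords, zVal_coords]
    have h1 := hR (uVal (base p)) (zVal (base p)) (wVal p)
    have h2 : t ^ 2 * t⁻¹ ^ 2 = 1 := by rw [← mul_pow, mul_inv_cancel₀ ht0, one_pow]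
    linear_combination h1 + uVal (base p) ^ 2 *
      (yVal (base p) - eval ![uVal (base p), zVal (base p), wVal p] R) * h2

/-! ### Automorphisms of the ambient space -/

lemma hyperPoly_ne_zero (q : Polynomial ℂ) (c : ℂ) : hyperPoly n q c ≠ 0 := by
  intro h
  have h1 := eval_hyperPoly q c (coords (fun _ : Fin n => (1 : ℂ)) (1 + c - q.eval 0) 0)
  rw [h] at h1
  simp at h1

/-- An automorphism that maps one hypersurface onto the other multiplies the equation by a
constant, because both equations generate the ideals of their zero sets. -/
lemma exists_scalar_of_image_eq {q q' : Polynomial ℂ} {Φ : PolyAut (n + 2)}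
    (h : Φ.toMap '' zeroSet (hyperPoly n q 0) = zeroSet (hyperPoly n q' 0)) :
    ∃ s : ℂ, s ≠ 0 ∧ ∀ p, eval (polyMap Φ.comp p) (hyperPoly n q' 0) =
      s * eval p (hyperPoly n q 0) := by
  obtain ⟨a, ha⟩ : hyperPoly n q 0 ∣ aeval Φ.comp (hyperPoly n q' 0) := by
    refine hyperPoly_dvd_of_vanish fun p hp _ _ => ?_
    rw [eval_aeval]
    have : Φ.toMap p ∈ zeroSet (hyperPoly n q' 0) := h ▸ Set.mem_image_of_mem _ hp
    exact this
  obtain ⟨b, hb⟩ : hyperPoly n q' 0 ∣ aeval Φ.invComp (hyperPoly n q 0) := by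
    refine hyperPoly_dvd_of_vanish fun p hp _ _ => ?_
    rw [eval_aeval]
    rw [← h] at hp
    obtain ⟨p₀, hp₀, rfl⟩ := hp
    rw [PolyAut.toMap, Φ.left_inv p₀]
    exact hp₀
  have ha' : ∀ p, eval (polyMap Φ.comp p) (hyperPoly n q' 0) =
      eval p (hyperPoly n q 0) * eval p a := fun p => by rw [← eval_aeval, ha, map_mul]
  have hb' : ∀ p, eval (polyMap Φ.invComp p) (hyperPoly n q 0) =
      eval p (hyperPoly n q' 0) * eval p b := fun p => by rw [← eval_aeval, hb, map_mul]
  have hone : aeval Φ.invComp a * b = 1 := by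
    apply mul_left_cancel₀ (hyperPoly_ne_zero (n := n) q' 0)
    apply MvPolynomial.funext
    intro p
    have h1 := ha' (polyMap Φ.invComp p)
    rw [Φ.right_inv p, hb'] at h1
    rw [map_mul, map_mul, eval_aeval, mul_one]
    linear_combination -h1
  obtain ⟨s, hs, hsa⟩ := isUnit_iff_eq_C_of_isReduced.mp (IsUnit.of_mul_eq_one _ hone)
  refine ⟨s, hs.ne_zero, fun p => ?_⟩
  have h1 : eval p a = s := by
    have := congrArg (eval (polyMap Φ.comp p)) hsa
    rwa [eval_aeval, Φ.left_inv p, eval_C] at this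
  rw [ha', h1, mul_comm]

/-- On every fibre of the equation an automorphism that maps `V(q)` to `V(q')` is an isomorphism
onto a fibre of the other equation. The factor by which it multiplies `u` is a polynomial in the
value of the fibre without zeros, hence a constant. -/
lemma exists_scalars_of_image_eq (hn : 1 ≤ n) {q q' : Polynomial ℂ} {Φ : PolyAut (n + 2)}
    (h : Φ.toMap '' zeroSet (hyperPoly n q 0) = zeroSet (hyperPoly n q' 0)) :
    ∃ s μ : ℂ, s ≠ 0 ∧ μ ≠ 0 ∧ ∀ c, ∃ β : ℂ, s * c = β ^ 2 * c ∧
      q'.eval (s * c) * μ = β ^ 2 * q.eval c := by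
  obtain ⟨s, hs, hΦ⟩ := exists_scalar_of_image_eq h
  have hfib : ∀ (q : Polynomial ℂ) (c : ℂ) (p : AffSpace (n + 2)),
      p ∈ zeroSet (hyperPoly n q c) ↔ eval p (hyperPoly n q 0) = c := by
    intro q c p
    rw [mem_zeroSet_hyperPoly, eval_hyperPoly, sub_zero]
  have key : ∀ c : ℂ, ∃ μ β : ℂ, μ ≠ 0 ∧ (∀ p ∈ zeroSet (hyperPoly n q c),
      uVal (polyMap Φ.comp p) = μ * uVal p) ∧ s * c = β ^ 2 * c ∧
      q'.eval (s * c) * μ = β ^ 2 * q.eval c := by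
    intro c
    obtain ⟨g₁, h₁, hg₁, hh₁, hl₁, hr₁⟩ := exists_normalization (n := n) q c
    obtain ⟨g₂, h₂, hg₂, hh₂, hl₂, hr₂⟩ := exists_normalization (n := n) q' (s * c)
    have hΦm : Set.MapsTo (polyMap Φ.comp) (zeroSet (hyperPoly n q c))
        (zeroSet (hyperPoly n q' (s * c))) := by
      intro p hp
      rw [hfib] at hp ⊢
      rw [hΦ, hp]
    have hΨm : Set.MapsTo (polyMap Φ.invComp) (zeroSet (hyperPoly n q' (s * c)))
        (zeroSet (hyperPoly n q c)) := by
      intro p hp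
      rw [hfib] at hp ⊢
      have h1 := hΦ (polyMap Φ.invComp p)
      rw [Φ.right_inv p, hp] at h1
      exact (mul_left_cancel₀ hs h1).symm
    -- the automorphism between the normalised fibres
    let F : Fin (n + 2) → PolyRing (n + 2) := fun j =>
      aeval (fun i => aeval (replaceY h₁) (Φ.comp i)) (replaceY g₂ j)
    let G : Fin (n + 2) → PolyRing (n + 2) := fun j =>
      aeval (fun i => aeval (replaceY h₂) (Φ.invComp i)) (replaceY g₁ j)
    have hF : polyMap F = polyMap (replaceY g₂) ∘ polyMap Φ.comp ∘ polyMap (replaceY h₁) := by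
      simp only [F]
      rw [polyMap_comp_eq, polyMap_comp_eq]
    have hG : polyMap G = polyMap (replaceY g₁) ∘ polyMap Φ.invComp ∘ polyMap (replaceY h₂) := by
      simp only [G]
      rw [polyMap_comp_eq, polyMap_comp_eq]
    obtain ⟨μ, β, hμ, -, hu, hc, hq⟩ := exists_scalars_of_isomorphism hn (F := F) (G := G)
      (α := q.eval c) (c := c) (α' := q'.eval (s * c)) (c' := s * c)
      (by rw [hF]; exact hg₂.comp (hΦm.comp hh₁))
      (by rw [hG]; exact hg₁.comp (hΨm.comp hh₂))
      (by
        intro p hp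
        rw [hF, hG]
        simp only [Function.comp_apply]
        rw [hl₂ (hΦm (hh₁ hp)), Φ.left_inv, hr₁ hp])
      (by
        intro p hp
        rw [hF, hG]
        simp only [Function.comp_apply]
        rw [hl₁ (hΨm (hh₂ hp)), Φ.right_inv, hr₂ hp])
    refine ⟨μ, β, hμ, fun p hp => ?_, hc, hq⟩
    have h1 := hu _ (hg₁ hp)
    rw [hF] at h1
    simp only [Function.comp_apply] at h1
    rwa [hl₁ hp, uVal_replaceY, uVal_replaceY] at h1
  choose μ β hμ hu hc hq using key
  -- the factor, as a polynomial in the value of the fibre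
  let m : Polynomial ℂ := aeval (coords (fun _ => 1) (Polynomial.X - Polynomial.C (q.eval 0)) 0 :
    Fin (n + 2) → Polynomial ℂ) (aeval Φ.comp (xProd n))
  have hm : ∀ c, m.eval c = μ c := by
    intro c
    have h1 : ∀ f : PolyRing (n + 2),
        (aeval (coords (fun _ => 1) (Polynomial.X - Polynomial.C (q.eval 0)) 0 :
          Fin (n + 2) → Polynomial ℂ) f).eval c =
        eval (coords (fun _ : Fin n => (1 : ℂ)) (c - q.eval 0) 0) f := by
      intro f
      rw [← Polynomial.coe_aeval_eq_eval, ← MvPolynomial.coe_aeval_eq_eval]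
      have : ((Polynomial.aeval c).comp (aeval (coords (fun _ => 1)
          (Polynomial.X - Polynomial.C (q.eval 0)) 0 : Fin (n + 2) → Polynomial ℂ)) :
          PolyRing (n + 2) →ₐ[ℂ] ℂ) =
          aeval (coords (fun _ : Fin n => (1 : ℂ)) (c - q.eval 0) 0) := by
        apply MvPolynomial.algHom_ext
        exact forall_coords (fun i => by simp) (by simp) (by simp)
      exact DFunLike.congr_fun this f
    simp only [m]
    rw [h1, eval_aeval, eval_xProd, hu c]
    · simp
    · rw [mem_zeroSet_hyperPoly]
      simp
  have hdeg : m.degree = 0 := by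
    by_contra hne
    obtain ⟨r, hr⟩ := IsAlgClosed.exists_root m hne
    exact hμ r (by rw [← hm]; exact hr)
  rw [Polynomial.eq_C_of_degree_eq_zero hdeg] at hm
  simp only [Polynomial.eval_C] at hm
  refine ⟨s, m.coeff 0, hs, by rw [hm 0]; exact hμ 0, fun c => ⟨β c, hc c, ?_⟩⟩
  rw [hm c]
  exact hq c

/-- The zero sets of `Q_k` and `Q_l` are equivalent only for `k = l`: the relation between the
fibres determines the polynomial `q = (X - 1)^k`. -/
lemma eq_of_equivalentVarieties (hn : 1 ≤ n) {k l : ℕ} (hk : 1 ≤ k) (hl : 1 ≤ l)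
    (h : EquivalentVarieties (zeroSet (polyQ n k)) (zeroSet (polyQ n l))) : k = l := by
  have hQ : ∀ k, polyQ n k = hyperPoly n ((Polynomial.X - 1) ^ k) 0 := fun k => by
    rw [← polyQ_sub_C, C_0, sub_zero]
  rw [hQ, hQ] at h
  obtain ⟨Φ, hΦ⟩ := h
  obtain ⟨s, μ, hs, hμ, H⟩ := exists_scalars_of_image_eq hn hΦ
  have H' : ∀ c : ℂ, c ≠ 0 → (s * c - 1) ^ l * μ = s * (c - 1) ^ k := by
    intro c hc
    obtain ⟨β, h1, h2⟩ := H c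
    rw [← mul_right_cancel₀ hc h1] at h2
    simpa using h2
  have hs1 : s = 1 := by
    have := H' 1 one_ne_zero
    rw [sub_self, zero_pow (by omega), mul_zero, mul_one] at this
    exact sub_eq_zero.mp (pow_eq_zero_iff (by omega) |>.mp ((mul_eq_zero.mp this).resolve_right hμ))
  subst hs1
  have h2 := H' 2 two_ne_zero
  have h3 := H' 3 three_ne_zero
  norm_num at h2
  rw [h2] at h3
  norm_num at h3
  have h4 : (2 : ℕ) ^ l = 2 ^ k := by exact_mod_cast h3
  exact (Nat.pow_right_injective le_rfl h4).symm

/-- For `c = 1` the polynomial `X - a` vanishes at `c` exactly if `a = 1`. -/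
lemma not_isomorphicVarieties_polyP (hn : 1 ≤ n) :
    ¬ IsomorphicVarieties (zeroSet (polyP n 1 - 1)) (zeroSet (polyP n 2 - 1)) := by
  rw [polyP_sub_one, polyP_sub_one]
  intro h
  have h1 := ((isomorphic_normalization _ _).symm.trans h).trans (isomorphic_normalization _ _)
  obtain ⟨F, G, hF, hG, hFG, hGF⟩ := h1
  obtain ⟨μ, β, hμ, -, -, -, h2⟩ := exists_scalars_of_isomorphism hn hF hG hFG hGF
  norm_num at h2
  exact hμ h2

end StableEquiv

theorem mainTheorem1 (n : ℕ) (hn : 1 ≤ n) :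
    (¬ StableEquiv.IsomorphicVarieties
        (StableEquiv.zeroSet (StableEquiv.polyP n 1 - 1))
        (StableEquiv.zeroSet (StableEquiv.polyP n 2 - 1)) ∧
      ¬ StableEquiv.EquivalentVarieties
        (StableEquiv.zeroSet (StableEquiv.polyP n 1 - 1))
        (StableEquiv.zeroSet (StableEquiv.polyP n 2 - 1)) ∧
      StableEquiv.EquivalentVarieties
        (StableEquiv.cylinder (StableEquiv.zeroSet (StableEquiv.polyP n 1 - 1)) 1)
        (StableEquiv.cylinder (StableEquiv.zeroSet (StableEquiv.polyP n 2 - 1)) 1) ∧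
      StableEquiv.StablyEquivalentPolynomials
        (StableEquiv.polyP n 1 - 1) (StableEquiv.polyP n 2 - 1)) ∧
    ((∀ k k' : ℕ, 1 ≤ k → 1 ≤ k' →
        StableEquiv.StablyEquivalentPolynomials
          (StableEquiv.polyQ n k) (StableEquiv.polyQ n k')) ∧
      (∀ k k' : ℕ, 1 ≤ k → 1 ≤ k' → k ≠ k' →
        ¬ StableEquiv.EquivalentVarieties
          (StableEquiv.zeroSet (StableEquiv.polyQ n k))
          (StableEquiv.zeroSet (StableEquiv.polyQ n k'))) ∧
      (∀ k k' : ℕ, 1 ≤ k → 1 ≤ k' → ∀ c : ℂ,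
        StableEquiv.IsomorphicVarieties
          (StableEquiv.zeroSet (StableEquiv.polyQ n k - MvPolynomial.C c))
          (StableEquiv.zeroSet (StableEquiv.polyQ n k' - MvPolynomial.C c)))) := by
  have hP : ∀ a : ℂ, (Polynomial.X - Polynomial.C a).eval 0 = -a := fun a => by simp
  have hQ : ∀ k : ℕ, ((Polynomial.X - 1 : Polynomial ℂ) ^ k).eval 0 ≠ 0 := fun k => by simp
  have hE := fun {a b : ℂ} (ha : a ≠ 0) (hb : b ≠ 0) =>
    StableEquiv.equivalent_rename_hyperPoly hn (q := Polynomial.X - Polynomial.C a)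
      (q' := Polynomial.X - Polynomial.C b) (by rw [hP]; exact neg_ne_zero.mpr ha)
      (by rw [hP]; exact neg_ne_zero.mpr hb) 1
  refine ⟨⟨StableEquiv.not_isomorphicVarieties_polyP hn,
    fun h => StableEquiv.not_isomorphicVarieties_polyP hn h.isomorphic, ?_, 1, ?_⟩,
    fun k k' _ _ => ⟨1, ?_⟩, fun k k' hk hk' hne h =>
      hne (StableEquiv.eq_of_equivalentVarieties hn hk hk' h), fun k k' hk hk' c => ?_⟩
  · rw [StableEquiv.cylinder_zeroSet, StableEquiv.cylinder_zeroSet, StableEquiv.polyP_sub_one,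
      StableEquiv.polyP_sub_one]
    exact (hE two_ne_zero one_ne_zero).equivalentVarieties
  · rw [StableEquiv.polyP_sub_one, StableEquiv.polyP_sub_one]
    exact hE one_ne_zero two_ne_zero
  · have h0 : ∀ k, StableEquiv.polyQ n k =
        StableEquiv.hyperPoly n ((Polynomial.X - 1) ^ k) 0 := fun k => by
      rw [← StableEquiv.polyQ_sub_C, MvPolynomial.C_0, sub_zero]
    rw [h0, h0]
    exact StableEquiv.equivalent_rename_hyperPoly hn (hQ k) (hQ k') 0
  · rw [StableEquiv.polyQ_sub_C, StableEquiv.polyQ_sub_C]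
    refine StableEquiv.isomorphic_of_eval_eq_zero_iff hn ?_
    simp [Nat.one_le_iff_ne_zero.mp hk, Nat.one_le_iff_ne_zero.mp hk']
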